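/- Let $\varphi:\mathbb R\to\mathbb R$ be differentiable, with $\varphi\in L^1(\mathbb R)$, $\varphi(v)\to0$ as $v\to\pm\infty$, $\varphi'$ bounded, and $\varphi'(s)\ne0$ at every zero $s$ of $\varphi$. For $\operatorname{Re}\lambda>0$ put $$\Delta(k,\lambda)=1+\frac1{ik}\int_{-\infty}^{\infty}\frac{\varphi(v)}{ikv+\lambda}\,dv\quad(k\in\mathbb R\setminus\{0\}),\qquad \Delta(0,\lambda)=1-\frac1{\lambda^2}\int_{-\infty}^{\infty}v\,\varphi(v)\,dv .$$ (a) Let $k\in\mathbb R\setminus\{0\}$ be such that $1-\frac1{k^2}\int_{-\infty}^{\infty}\frac{\varphi(v)}{v-s}\,dv\ne0$ for every zero $s$ of $\varphi$. Then $\Delta(k,\cdot)$ is analytic in the half-plane $\operatorname{Re}\lambda>0$ and has finitely many roots there, and their number $N(k)$, counted with multiplicity, is $$N(k)=N_+(k)-N_-(k),$$ where $N_+(k)$ (respectively $N_-(k)$) is the number, which is finite, of those $s\in\mathbb R$ with $\varphi(s)=0$, $\varphi'(s)>0$ (respectively $\varphi'(s)<0$) and $1-\frac1{k^2}\int_{-\infty}^{\infty}\frac{\varphi(v)}{v-s}\,dv<0$.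 (b) Suppose in addition that $\int_{-\infty}^{\infty}|v|\,|\varphi(v)|\,dv<\infty$ (the condition on $k$ in (a) is not needed here). Then the equation $\Delta(0,\lambda)=0$ has at most one root in the half-plane $\operatorname{Re}\lambda>0$, and it has one if and only if $\int_{-\infty}^{\infty}v\,\varphi(v)\,dv>0$. -/

import Mathlib

noncomputable section

/-- The Landau dispersion function `Δ(k, z)` of the profile `φ`:
`1 + (1 / (i k)) ∫ φ(v) / (i k v + z) dv` for `k ≠ 0`, and
`1 - (1 / z²) ∫ v φ(v) dv` for `k = 0`. -/
def landauDelta (φ : ℝ → ℝ) (k : ℝ) (z : ℂ) : ℂ :=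
  if k = 0 then 1 - 1 / z ^ 2 * ((∫ v : ℝ, v * φ v : ℝ) : ℂ)
  else 1 + 1 / (Complex.I * (k : ℂ)) *
    ∫ v : ℝ, (φ v : ℂ) / (Complex.I * (k : ℂ) * (v : ℂ) + z)

/-- The set `Λ(k)` of singular values: roots of `Δ(k, ·)` off the imaginary axis. -/
def singularValues (φ : ℝ → ℝ) (k : ℝ) : Set ℂ :=
  {z : ℂ | z.re ≠ 0 ∧ landauDelta φ k z = 0}

/-- The singular values in the open right half-plane. -/
def unstableRoots (φ : ℝ → ℝ) (k : ℝ) : Set ℂ :=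
  {z : ℂ | z ∈ singularValues φ k ∧ 0 < z.re}

/-- The instability index `N(k)`: the number of roots of `Δ(k, ·)` in the open right
half-plane, each counted with its multiplicity (order of vanishing). -/
def instabilityIndex (φ : ℝ → ℝ) (k : ℝ) : ℕ :=
  ∑ᶠ z ∈ unstableRoots φ k, analyticOrderNatAt (landauDelta φ k) z

/-- The real number `1 - k⁻² ∫ φ(v) / (v - s) dv`, used at zeros `s` of `φ`. -/
def penroseValue (φ : ℝ → ℝ) (k s : ℝ) : ℝ :=
  1 - 1 / k ^ 2 * ∫ v : ℝ, φ v / (v - s)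

/-- The zeros counted by `N₊(k)`. -/
def upZeros (φ : ℝ → ℝ) (k : ℝ) : Set ℝ :=
  {s : ℝ | φ s = 0 ∧ 0 < deriv φ s ∧ penroseValue φ k s < 0}

/-- The zeros counted by `N₋(k)`. -/
def downZeros (φ : ℝ → ℝ) (k : ℝ) : Set ℝ :=
  {s : ℝ | φ s = 0 ∧ deriv φ s < 0 ∧ penroseValue φ k s < 0}

end

open Filter Topology Complex Bornology MeasureTheory

/-! This is Penrose's winding number argument. The substitution `u = k v` turns `Δ(k, ·)` into `F z
= 1 - ∫ ψ(v) / (v - i z) dv`, where `ψ` is the `rescaledProfile`; its zeros, and the signs of its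
derivative there, correspond to those of `φ` (`landauDelta_eq_cauchyTransform`, `penroseValue_eq`,
`deriv_rescaledProfile`).

By Plemelj's formula (`exists_tendsto_cauchyTransform`), `F` extends continuously to the imaginary
axis. Its value `γ(s)` at `-i s` has imaginary part `-π ψ(s)`, and at a zero of `ψ` its real part is
the Penrose value. These values are nonzero by assumption, so `γ` avoids `0`. Since `F → 1` at
infinity (`tendsto_cauchyTransform_cobounded`), the argument principle
(`exists_continuous_phase_of_halfPlane`) says that the phase of `γ` grows by `2π` times the number
of roots.

The same growth is found by counting passages of `γ` through the negative real axis
(`card_negative_axis_crossings`). These occur exactly at zeros of `ψ` with negative Penrose value.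
Where `ψ` increases, `γ` goes from above the axis to below it, so the phase rises through an odd
multiple of `π`; where `ψ` decreases, it falls. The difference of the two counts is `N₊ - N₋`.

The argument principle is proved without contour integrals: after division by Blaschke factors the
function has a continuous logarithm, and the phase of each factor is an explicit arctangent. For `k
= 0` the equation is `z ^ 2 = ∫ v φ(v) dv`. -/

/-! ### Continuous logarithms of functions tending to `1` at infinity. -/

/-- A continuous real function taking integer values on a preconnected set is constant there. -/
theorem IsPreconnected.exists_eq_intCast {X : Type*} [TopologicalSpace X] {S : Set X}
    (hS : IsPreconnected S) {f : X → ℝ} (hf : ContinuousOn f S)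
    (hint : ∀ x ∈ S, ∃ n : ℤ, f x = n) : ∃ n : ℤ, ∀ x ∈ S, f x = n := by
  have : DiscreteTopology (Set.range ((↑) : ℤ → ℝ)) :=
    Int.isClosedEmbedding_coe_real.isEmbedding.toHomeomorph.symm.isEmbedding.discreteTopology
  obtain ⟨y, ⟨n, rfl⟩, h⟩ := hS.eqOn_const_of_mapsTo (T := Set.range ((↑) : ℤ → ℝ)) ⟨this⟩ hf
    (fun x hx => by obtain ⟨n, hn⟩ := hint x hx; exact ⟨n, hn.symm⟩) ⟨_, 0, rfl⟩
  exact ⟨n, fun x hx => h hx⟩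

/-- A continuous nonvanishing function on the plane which tends to `1` at infinity has a continuous
logarithm which tends to a multiple of `2πi` at infinity. -/
theorem exists_continuous_log_of_tendsto_one {h : ℂ → ℂ} (hc : Continuous h) (h0 : ∀ z, h z ≠ 0)
    (hinf : Tendsto h (cobounded ℂ) (𝓝 1)) :
    ∃ L : ℂ → ℂ, Continuous L ∧ (∀ z, exp (L z) = h z) ∧
      ∃ m : ℤ, Tendsto L (cobounded ℂ) (𝓝 (2 * Real.pi * m * I)) := by
  -- The plane is simply connected, so `h` lifts through the covering `exp : ℂ → ℂ \ {0}`.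
  obtain ⟨F, ⟨-, hF⟩, -⟩ := isCoveringMapOn_exp.existsUnique_continuousMap_lifts ⟨h, hc⟩
    (exp_log (h0 0)) h0
  have hF' : ∀ z, exp (F z) = h z := fun z => congrFun hF z
  refine ⟨F, F.continuous, hF', ?_⟩
  have hslit : ∀ᶠ z in cobounded ℂ, h z ∈ slitPlane :=
    hinf.eventually (isOpen_slitPlane.mem_nhds one_mem_slitPlane)
  obtain ⟨R, -, hR⟩ := (Metric.hasBasis_cobounded_compl_closedBall (0 : ℂ)).eventually_iff.1 hslit
  -- `exp` maps this half-plane onto the exterior of a disc, so convexity of `S` stands in for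
  -- connectedness of the exterior. The maximum with `1` keeps the argument of `Real.log` positive.
  set S : Set ℂ := {ζ | Real.log (max R 1) < ζ.re}
  have hS : IsPreconnected S := (convex_halfSpace_re_gt _).isPreconnected
  have hSR : ∀ ζ ∈ S, h (exp ζ) ∈ slitPlane := fun ζ hζ => by
    refine hR ?_
    simp only [Set.mem_compl_iff, Metric.mem_closedBall, dist_zero_right, not_le, norm_exp]
    exact (le_max_left R 1).trans_lt ((Real.log_lt_iff_lt_exp (by positivity)).1 hζ)
  have key : ∀ z, ∃ n : ℤ, F z = log (h z) + n * (2 * Real.pi * I) := fun z =>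
    exp_eq_exp_iff_exists_int.1 (by rw [hF', exp_log (h0 z)])
  obtain ⟨m, hm⟩ := hS.exists_eq_intCast (f := fun ζ => (F (exp ζ) - log (h (exp ζ))).im /
    (2 * Real.pi)) (by
      refine ContinuousOn.div_const (continuous_im.comp_continuousOn ?_) _
      refine ContinuousOn.sub (by fun_prop) ?_
      exact ContinuousOn.clog (by fun_prop) hSR)
    (fun ζ _ => by
      obtain ⟨n, hn⟩ := key (exp ζ)
      refine ⟨n, ?_⟩
      rw [hn, div_eq_iff (by positivity)]
      simp)
  refine ⟨m, ?_⟩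
  have hlog : Tendsto (fun z => log (h z) + m * (2 * Real.pi * I)) (cobounded ℂ)
      (𝓝 (log 1 + m * (2 * Real.pi * I))) := (hinf.clog one_mem_slitPlane).add_const _
  rw [log_one, zero_add] at hlog
  have e : (2 * Real.pi * m * I : ℂ) = m * (2 * Real.pi * I) := by ring
  rw [e]
  refine hlog.congr' ?_
  filter_upwards [(Metric.hasBasis_cobounded_compl_closedBall (0 : ℂ)).mem_of_mem
    (i := max R 1) trivial] with z hz
  simp only [Set.mem_compl_iff, Metric.mem_closedBall, dist_zero_right, not_le] at hz
  have hz0 : z ≠ 0 := by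
    rintro rfl
    rw [norm_zero] at hz
    exact absurd hz (not_lt.2 (le_max_of_le_right zero_le_one))
  have hzS : log z ∈ S := by
    simp only [S, Set.mem_ofPred_eq, log_re]
    exact Real.log_lt_log (by positivity) hz
  have h1 := hm _ hzS
  simp only [exp_log hz0] at h1
  obtain ⟨n, hn⟩ := key z
  have : (n : ℝ) = m := by
    rw [← h1, hn, eq_div_iff (by positivity)]
    simp
  rw [hn, Int.cast_injective this]

/-! ### Dividing out zeros; phases of Blaschke factors. -/

/-- Finitely many zeros of an analytic function can be divided out. -/
theorem AnalyticOnNhd.exists_eq_prod_mul {U : Set ℂ} {g : ℂ → ℂ} (hg : AnalyticOnNhd ℂ g U)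
    (hfin : ∀ z ∈ U, analyticOrderAt g z ≠ ⊤) (S : Finset ℂ) (hS : ↑S ⊆ U) :
    ∃ G : ℂ → ℂ, AnalyticOnNhd ℂ G U ∧
      (∀ z, g z = (∏ u ∈ S, (z - u) ^ analyticOrderNatAt g u) * G z) ∧
      (∀ z ∈ S, G z ≠ 0) ∧ ∀ z ∈ U, z ∉ S → analyticOrderAt G z = analyticOrderAt g z := by
  classical
  induction S using Finset.induction_on with
  | empty => exact ⟨g, hg, by simp, by simp, by simp⟩
  | insert u S hu ih =>
    rw [Finset.coe_insert, Set.insert_subset_iff] at hS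
    obtain ⟨G, hGa, hGe, hG0, hGo⟩ := ih hS.2
    have huU := hS.1
    have hou : analyticOrderAt G u = analyticOrderNatAt g u := by
      rw [hGo u huU hu, Nat.cast_analyticOrderNatAt (hfin u huU)]
    obtain ⟨K, hKa, hK0, hK⟩ := (hGa u huU).analyticOrderAt_eq_natCast.1 hou
    set n := analyticOrderNatAt g u
    -- The update fills the removable singularity at `u` with the nonzero value `K u`.
    set H : ℂ → ℂ := Function.update (fun z => G z / (z - u) ^ n) u (K u) with hH
    have hHne : ∀ z, z ≠ u → H z = G z / (z - u) ^ n := fun z hz => by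
      rw [hH, Function.update_of_ne hz]
    have hHu : H u = K u := by rw [hH, Function.update_self]
    have hGH : ∀ z, G z = (z - u) ^ n * H z := fun z => by
      by_cases hz : z = u
      · subst hz; rw [hHu]; simpa using hK.self_of_nhds
      · rw [hHne z hz, mul_div_cancel₀]
        exact pow_ne_zero _ (sub_ne_zero.2 hz)
    have hHa : AnalyticOnNhd ℂ H U := fun z hz => by
      by_cases hzu : z = u
      · subst hzu
        refine hKa.congr ?_
        filter_upwards [hK] with w hw
        by_cases hwz : w = z
        · rw [hwz, hHu]
        · rw [hHne w hwz, hw, smul_eq_mul, mul_div_cancel_left₀]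
          exact pow_ne_zero _ (sub_ne_zero.2 hwz)
      · have : AnalyticAt ℂ (fun z => G z / (z - u) ^ n) z :=
          (hGa z hz).div (by fun_prop) (pow_ne_zero _ (sub_ne_zero.2 hzu))
        refine this.congr ?_
        filter_upwards [isOpen_ne.mem_nhds hzu] with w hw using (hHne w hw).symm
    refine ⟨H, hHa, fun z => ?_, fun z hz => ?_, fun z hz hzS => ?_⟩
    · rw [hGe z, hGH z, Finset.prod_insert hu]; ring
    · rcases Finset.mem_insert.1 hz with rfl | hz
      · rwa [hHu]
      · have := hG0 z hz
        rw [hGH z] at this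
        exact right_ne_zero_of_mul this
    · rw [Finset.mem_insert, not_or] at hzS
      rw [← hGo z hz hzS.2]
      have : G = (fun z => (z - u) ^ n) * H := funext hGH
      have hA : AnalyticAt ℂ (fun z => (z - u) ^ n) z := by fun_prop
      rw [this, analyticOrderAt_mul hA (hHa z hz), (hA.analyticOrderAt_eq_zero).2, zero_add]
      exact pow_ne_zero _ (sub_ne_zero.2 hzS.1)

/-- `1 + t i` has argument `arctan t`, and dividing it by its conjugate doubles the argument. -/
theorem Complex.exp_two_mul_arctan_mul_I (t : ℝ) :
    exp ((2 * Real.arctan t : ℝ) * I) = (1 + t * I) / (1 - t * I) := by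
  have hs : (0 : ℝ) < 1 + t ^ 2 := by positivity
  have h1 : (1 - t * I : ℂ) ≠ 0 := fun h => by simpa using congrArg re h
  have h2 : ((√(1 + t ^ 2) : ℝ) : ℂ) ^ 2 = (1 + t * I) * (1 - t * I) := by
    rw [← ofReal_pow, Real.sq_sqrt hs.le]
    push_cast
    linear_combination (t : ℂ) ^ 2 * I_sq
  have h3 : ((√(1 + t ^ 2) : ℝ) : ℂ) ≠ 0 := by
    rw [Ne, ofReal_eq_zero, Real.sqrt_eq_zero hs.le]; exact hs.ne'
  have h4 : exp ((Real.arctan t : ℝ) * I) = (1 + t * I) / ((√(1 + t ^ 2) : ℝ) : ℂ) := by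
    rw [exp_mul_I, ← ofReal_cos, ← ofReal_sin, Real.cos_arctan, Real.sin_arctan]
    push_cast
    field_simp
  have h5 : ((2 * Real.arctan t : ℝ) * I : ℂ) = (2 : ℕ) * ((Real.arctan t : ℝ) * I) := by
    push_cast; ring
  rw [h5, exp_nat_mul, h4, div_pow, h2]
  have h6 : (1 + t * I : ℂ) ≠ 0 := fun h => by simpa using congrArg re h
  field_simp

/-- The phase on the imaginary axis of the Blaschke factor of the right half-plane with a zero at
`u`, as a function of minus the imaginary part. -/
noncomputable def blaschkePhase (u : ℂ) (s : ℝ) : ℝ :=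
  2 * Real.arctan ((s + u.im) / u.re) - Real.pi

theorem continuous_blaschkePhase (u : ℂ) : Continuous (blaschkePhase u) := by
  unfold blaschkePhase
  exact (continuous_const.mul (Real.continuous_arctan.comp (by fun_prop))).sub continuous_const

/-- The shift by `-π` makes the phase end at `0`, so the total increase `2π` of each factor is
visible in the limit at `-∞`. -/
theorem tendsto_blaschkePhase_atTop {u : ℂ} (hu : 0 < u.re) :
    Tendsto (blaschkePhase u) atTop (𝓝 0) := by
  have h : Tendsto (fun s : ℝ => (s + u.im) / u.re) atTop atTop :=
    (tendsto_id.atTop_add tendsto_const_nhds).atTop_div_const hu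
  have := ((((Real.tendsto_arctan_atTop.mono_right nhdsWithin_le_nhds).comp h).const_mul 2).sub_const
    Real.pi)
  rwa [show 2 * (Real.pi / 2) - Real.pi = 0 by ring] at this

theorem tendsto_blaschkePhase_atBot {u : ℂ} (hu : 0 < u.re) :
    Tendsto (blaschkePhase u) atBot (𝓝 (-(2 * Real.pi))) := by
  have h : Tendsto (fun s : ℝ => (s + u.im) / u.re) atBot atBot :=
    (tendsto_id.atBot_add tendsto_const_nhds).atBot_div_const hu
  have := ((((Real.tendsto_arctan_atBot.mono_right nhdsWithin_le_nhds).comp h).const_mul 2).sub_const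
    Real.pi)
  rwa [show 2 * -(Real.pi / 2) - Real.pi = -(2 * Real.pi) by ring] at this

theorem exp_blaschkePhase {u : ℂ} (hu : 0 < u.re) (s : ℝ) :
    exp (blaschkePhase u s * I) = (-(I * s) - u) / (-(I * s) + (starRingEnd ℂ) u) := by
  have e : (blaschkePhase u s * I : ℂ) =
      (2 * Real.arctan ((s + u.im) / u.re) : ℝ) * I - Real.pi * I := by
    unfold blaschkePhase; push_cast; ring
  rw [e, exp_sub, exp_pi_mul_I, exp_two_mul_arctan_mul_I]
  have hre : (u.re : ℂ) ≠ 0 := ofReal_ne_zero.2 hu.ne'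
  have h1 : (1 - ((s + u.im) / u.re : ℝ) * I : ℂ) ≠ 0 := fun h => by simpa using congrArg re h
  have h2 : (-(I * s) + (starRingEnd ℂ) u : ℂ) ≠ 0 := fun h => by
    have := congrArg re h
    simp at this
    exact hu.ne' this
  have e1 : (-(I * s) - u : ℂ) = -(u.re * (1 + ((s + u.im) / u.re : ℝ) * I)) := by
    push_cast; field_simp; nth_rewrite 1 [← re_add_im u]; ring
  have e2 : (-(I * s) + (starRingEnd ℂ) u : ℂ) = u.re * (1 - ((s + u.im) / u.re : ℝ) * I) := by
    push_cast; field_simp; apply Complex.ext <;> simp; ring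
  rw [e1, e2, div_neg, div_one, neg_div, mul_div_mul_left _ _ hre]

theorem tendsto_add_const_div_sub_const (u v : ℂ) :
    Tendsto (fun z : ℂ => (z + v) / (z - u)) (cobounded ℂ) (𝓝 1) := by
  have h : Tendsto (fun z : ℂ => 1 + (u + v) * (z - u)⁻¹) (cobounded ℂ) (𝓝 (1 + (u + v) * 0)) :=
    ((tendsto_inv₀_cobounded.comp (tendsto_sub_const_cobounded u)).const_mul _).const_add _
  rw [mul_zero, add_zero] at h
  refine h.congr' ?_
  filter_upwards [(eventually_ne_cobounded u)] with z hz
  have := sub_ne_zero.2 hz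
  field_simp
  ring

/-! ### The argument principle for the right half-plane. -/

section HalfPlane

variable {g : ℂ → ℂ}

/-- The limit at infinity confines the zeros to a compact set. An accumulation point is itself a
zero, hence not on the boundary, and the identity theorem would then give `g = 0`, against the limit
`1`. -/
theorem finite_zeros_of_halfPlane (hc : ContinuousOn g {z | 0 ≤ z.re})
    (ha : AnalyticOnNhd ℂ g {z | 0 < z.re}) (h0 : ∀ z, z.re = 0 → g z ≠ 0)
    (hinf : Tendsto g (cobounded ℂ ⊓ 𝓟 {z | 0 ≤ z.re}) (𝓝 1)) :
    {z | 0 < z.re ∧ g z = 0}.Finite ∧ ∀ z, 0 < z.re → analyticOrderAt g z ≠ ⊤ := by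
  have hev : ∀ᶠ z in cobounded ℂ, 0 ≤ z.re → g z ≠ 0 := by
    have := hinf.eventually (isOpen_ne.mem_nhds (one_ne_zero (α := ℂ)))
    rwa [eventually_inf_principal] at this
  obtain ⟨R, -, hR⟩ := (Metric.hasBasis_cobounded_compl_closedBall (0 : ℂ)).eventually_iff.1 hev
  have hpre : IsPreconnected {z : ℂ | 0 < z.re} := (convex_halfSpace_re_gt 0).isPreconnected
  set p : ℂ := ((|R| + 1 : ℝ) : ℂ)
  have hp : 0 < p.re := by simp only [p, ofReal_re]; positivity
  have hgp : g p ≠ 0 := by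
    refine hR ?_ hp.le
    simp only [Set.mem_compl_iff, Metric.mem_closedBall, dist_zero_right, not_le, p, norm_real,
      Real.norm_eq_abs]
    rw [abs_of_pos (by positivity : 0 < |R| + 1)]
    linarith [le_abs_self R]
  refine ⟨?_, fun z hz => ha.analyticOrderAt_ne_top_of_isPreconnected hpre (x := p) hp hz ?_⟩
  · have hK : IsCompact ({z : ℂ | 0 ≤ z.re} ∩ g ⁻¹' {0}) := by
      refine Metric.isCompact_of_isClosed_isBounded
        (hc.preimage_isClosed_of_isClosed (isClosed_le continuous_const continuous_re)
          isClosed_singleton) ?_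
      refine Metric.isBounded_closedBall.subset (t := Metric.closedBall 0 R) fun z hz => ?_
      by_contra hzR
      exact hR hzR hz.1 hz.2
    by_contra hinfinite
    obtain ⟨x, hx, hacc⟩ := Set.Infinite.exists_accPt_of_subset_isCompact hinfinite hK
      (fun z hz => ⟨hz.1.le, hz.2⟩)
    have hxre : 0 < x.re := lt_of_le_of_ne hx.1 fun h => h0 x h.symm hx.2
    have := ha.eqOn_zero_of_preconnected_of_frequently_eq_zero hpre hxre
      ((accPt_iff_frequently_nhdsNE.1 hacc).mono fun z hz => hz.2)
    exact hgp (this hp)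
  · rw [((ha p hp).analyticOrderAt_eq_zero).2 hgp]
    simp

/-- **Argument principle for the right half-plane.** If `g` is continuous on the closed right
half-plane, analytic inside, nonzero on the boundary and tends to `1` at infinity, then the phase
of `g` along the imaginary axis, traversed downwards, changes by `2π` times the number of zeros. -/
theorem exists_continuous_phase_of_halfPlane (hc : ContinuousOn g {z | 0 ≤ z.re})
    (ha : AnalyticOnNhd ℂ g {z | 0 < z.re}) (h0 : ∀ z, z.re = 0 → g z ≠ 0)
    (hinf : Tendsto g (cobounded ℂ ⊓ 𝓟 {z | 0 ≤ z.re}) (𝓝 1)) :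
    ∃ (Θ : ℝ → ℝ) (m : ℤ), Continuous Θ ∧
      (∀ s : ℝ, g (-(I * s)) = ‖g (-(I * s))‖ * exp (Θ s * I)) ∧
      Tendsto Θ atTop (𝓝 (2 * Real.pi * m)) ∧
      Tendsto Θ atBot (𝓝 (2 * Real.pi * (m -
        (∑ᶠ z ∈ {z | 0 < z.re ∧ g z = 0}, analyticOrderNatAt g z : ℕ)))) := by
  obtain ⟨hfin, hord⟩ := finite_zeros_of_halfPlane hc ha h0 hinf
  have hS : ∀ z ∈ hfin.toFinset, 0 < z.re := fun z hz => (hfin.mem_toFinset.1 hz).1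
  rw [finsum_mem_eq_finite_toFinset_sum _ hfin]
  set S := hfin.toFinset with hSdef
  set n := analyticOrderNatAt g
  obtain ⟨G, hGa, hGe, hG0, hGo⟩ := ha.exists_eq_prod_mul hord S hS
  replace hGe : ∀ z, g z = (∏ u ∈ S, (z - u) ^ n u) * G z := hGe
  have hconj : ∀ u ∈ S, ∀ z : ℂ, 0 ≤ z.re → z + (starRingEnd ℂ) u ≠ 0 := fun u hu z hz h => by
    have := congrArg re h
    simp only [add_re, conj_re, zero_re] at this
    linarith [hS u hu]
  have hGc : ContinuousOn G {z | 0 ≤ z.re} := fun z hz => by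
    rcases (show 0 ≤ z.re from hz).lt_or_eq with hz' | hz'
    · exact (hGa z hz').continuousAt.continuousWithinAt
    · have hp : (∏ u ∈ S, (z - u) ^ n u) ≠ 0 := by
        have := h0 z hz'.symm
        rw [hGe] at this
        exact left_ne_zero_of_mul this
      have hpc : ContinuousAt (fun z : ℂ => ∏ u ∈ S, (z - u) ^ n u) z := by fun_prop
      refine ((hc z hz).div hpc.continuousWithinAt hp).congr_of_eventuallyEq ?_ ?_
      · filter_upwards [mem_nhdsWithin_of_mem_nhds (hpc.eventually_ne hp)] with w hw
        rw [Pi.div_apply, hGe w, mul_div_cancel_left₀ _ hw]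
      · rw [Pi.div_apply, hGe z, mul_div_cancel_left₀ _ hp]
  have hGne : ∀ z : ℂ, 0 ≤ z.re → G z ≠ 0 := fun z hz => by
    by_cases hzS : z ∈ S
    · exact hG0 z hzS
    · have : g z ≠ 0 := fun h => by
        rcases hz.lt_or_eq with hz' | hz'
        · exact hzS (hfin.mem_toFinset.2 ⟨hz', h⟩)
        · exact h0 z hz'.symm h
      rw [hGe] at this
      exact right_ne_zero_of_mul this
  -- `h` is `g` divided by its Blaschke product: it has no zeros in the closed half-plane and still
  -- tends to `1`.
  set h : ℂ → ℂ := fun z => G z * ∏ u ∈ S, (z + (starRingEnd ℂ) u) ^ n u with hh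
  have hhc : ContinuousOn h {z | 0 ≤ z.re} := hGc.mul (by fun_prop)
  have hhne : ∀ z : ℂ, 0 ≤ z.re → h z ≠ 0 := fun z hz =>
    mul_ne_zero (hGne z hz) (Finset.prod_ne_zero_iff.2 fun u hu => pow_ne_zero _ (hconj u hu z hz))
  have hhinf : Tendsto h (cobounded ℂ ⊓ 𝓟 {z | 0 ≤ z.re}) (𝓝 1) := by
    have h1 : Tendsto (fun z : ℂ => ∏ u ∈ S, ((z + (starRingEnd ℂ) u) / (z - u)) ^ n u)
        (cobounded ℂ) (𝓝 (∏ u ∈ S, 1 ^ n u)) :=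
      tendsto_finsetProd _ fun u _ => (tendsto_add_const_div_sub_const _ _).pow _
    have h2 := hinf.mul (h1.mono_left inf_le_left)
    simp only [one_pow, Finset.prod_const_one, mul_one] at h2
    refine h2.congr' ?_
    have h3 : ∀ᶠ z in cobounded ℂ, ∀ u ∈ S, z ≠ u :=
      (Finset.eventually_all S).2 fun u _ => eventually_ne_cobounded u
    filter_upwards [h3.filter_mono inf_le_left] with z hz
    have hp : (∏ u ∈ S, (z - u) ^ n u) ≠ 0 :=
      Finset.prod_ne_zero_iff.2 fun u hu => pow_ne_zero _ (sub_ne_zero.2 (hz u hu))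
    simp only [div_pow, Finset.prod_div_distrib, hh]
    rw [hGe z]
    field_simp
  -- Folding along the imaginary axis makes `h ∘ P` a continuous nonvanishing function on the whole
  -- plane that agrees with `h` on the axis. Analyticity is no longer needed.
  set P : ℂ → ℂ := fun z => (|z.re| : ℝ) + z.im * I with hP
  have hPre : ∀ z, (P z).re = |z.re| := fun z => by simp [hP]
  have hPim : ∀ z, (P z).im = z.im := fun z => by simp [hP]
  have hPmem : ∀ z, 0 ≤ (P z).re := fun z => by rw [hPre]; exact abs_nonneg _
  have hPc : Continuous P := by simp only [hP]; fun_prop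
  have hPinf : Tendsto P (cobounded ℂ) (cobounded ℂ ⊓ 𝓟 {z | 0 ≤ z.re}) := by
    refine tendsto_inf.2 ⟨?_, tendsto_principal.2 (Eventually.of_forall hPmem)⟩
    rw [← tendsto_norm_atTop_iff_cobounded]
    have : (fun z => ‖P z‖) = fun z => ‖z‖ := funext fun z => by
      rw [norm_eq_sqrt_sq_add_sq, norm_eq_sqrt_sq_add_sq, hPre, hPim, sq_abs]
    rw [this]
    exact tendsto_norm_cobounded_atTop
  obtain ⟨L, hLc, hLe, m, hLm⟩ := exists_continuous_log_of_tendsto_one (h := h ∘ P)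
    (hhc.comp_continuous hPc hPmem) (fun z => hhne _ (hPmem z)) (hhinf.comp hPinf)
  have hax : ∀ s : ℝ, P (-(I * s)) = -(I * s) := fun s => by
    apply Complex.ext <;> simp [hP]
  have hgs : ∀ s : ℝ, g (-(I * s)) =
      exp (L (-(I * s)) + (∑ u ∈ S, n u * blaschkePhase u s : ℝ) * I) := fun s => by
    have e : ((∑ u ∈ S, n u * blaschkePhase u s : ℝ) * I : ℂ) =
        ∑ u ∈ S, (n u : ℂ) * (blaschkePhase u s * I) := by
      push_cast; rw [Finset.sum_mul]; exact Finset.sum_congr rfl fun _ _ => by ring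
    rw [exp_add, hLe, Function.comp_apply, hax, e, exp_sum, hGe, hh]
    have h1 : ∏ u ∈ S, exp ((n u : ℂ) * (blaschkePhase u s * I)) =
        (∏ u ∈ S, (-(I * s) - u) ^ n u) / ∏ u ∈ S, (-(I * s) + (starRingEnd ℂ) u) ^ n u := by
      rw [← Finset.prod_div_distrib]
      refine Finset.prod_congr rfl fun u hu => ?_
      rw [exp_nat_mul, exp_blaschkePhase (hS u hu), div_pow]
    have h2 : (∏ u ∈ S, (-(I * s) + (starRingEnd ℂ) u : ℂ) ^ n u) ≠ 0 :=
      Finset.prod_ne_zero_iff.2 fun u hu => pow_ne_zero _ (hconj u hu _ (by simp))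
    rw [h1]
    field_simp
  refine ⟨fun s => (L (-(I * s))).im + ∑ u ∈ S, n u * blaschkePhase u s, m, ?_, fun s => ?_, ?_, ?_⟩
  · refine (continuous_im.comp (hLc.comp (by fun_prop))).add (continuous_finsetSum _ fun u _ => ?_)
    exact continuous_const.mul (continuous_blaschkePhase u)
  · rw [hgs s, norm_exp, ofReal_exp, ← exp_add]
    congr 1
    apply Complex.ext <;> simp
  · have h1 : Tendsto (fun s : ℝ => (-(I * s) : ℂ)) atTop (cobounded ℂ) := by
      rw [← tendsto_norm_atTop_iff_cobounded]
      simpa using tendsto_abs_atTop_atTop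
    have h2 := (continuous_im.tendsto _).comp (hLm.comp h1)
    have h3 : Tendsto (fun s : ℝ => ∑ u ∈ S, n u * blaschkePhase u s) atTop
        (𝓝 (∑ u ∈ S, n u * 0)) :=
      tendsto_finsetSum _ fun u hu => (tendsto_blaschkePhase_atTop (hS u hu)).const_mul _
    have e : (2 * Real.pi * m * I : ℂ).im + ∑ u ∈ S, n u * (0 : ℝ) = 2 * Real.pi * m := by simp
    rw [← e]
    exact h2.add h3
  · have h1 : Tendsto (fun s : ℝ => (-(I * s) : ℂ)) atBot (cobounded ℂ) := by
      rw [← tendsto_norm_atTop_iff_cobounded]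
      simpa using tendsto_abs_atBot_atTop
    have h2 := (continuous_im.tendsto _).comp (hLm.comp h1)
    have h3 : Tendsto (fun s : ℝ => ∑ u ∈ S, n u * blaschkePhase u s) atBot
        (𝓝 (∑ u ∈ S, n u * -(2 * Real.pi))) :=
      tendsto_finsetSum _ fun u hu => (tendsto_blaschkePhase_atBot (hS u hu)).const_mul _
    have e : (2 * Real.pi * m * I : ℂ).im + ∑ u ∈ S, n u * -(2 * Real.pi) =
        2 * Real.pi * (m - (∑ u ∈ S, n u : ℕ)) := by
      rw [← Finset.sum_mul]
      push_cast
      simp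
      ring
    rw [← e]
    exact h2.add h3

end HalfPlane

/-! ### Signed counting of crossings. -/

theorem Int.floor_eventuallyEq_of_notMem_range {f : ℝ → ℝ} {x : ℝ} (hf : ContinuousAt f x)
    (hx : ∀ n : ℤ, f x ≠ n) : ∀ᶠ y in 𝓝 x, ⌊f y⌋ = ⌊f x⌋ := by
  have h1 : (⌊f x⌋ : ℝ) < f x := lt_of_le_of_ne (Int.floor_le _) (hx _).symm
  filter_upwards [hf.eventually (lt_mem_nhds h1), hf.eventually (gt_mem_nhds (Int.lt_floor_add_one _))]
    with y hy1 hy2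
  exact Int.floor_eq_iff.2 ⟨hy1.le, hy2⟩

/-- If a continuous function tends to half-integers `M + 1/2` at `+∞` and `M - N + 1/2` at `-∞` and
takes integer values exactly on `U ∪ D`, crossing upwards on `U` and downwards on `D`, then `U` and
`D` are finite and `N` is the difference of their cardinalities. -/
theorem card_crossings {f : ℝ → ℝ} (hf : Continuous f) {U D : Set ℝ}
    (hUD : ∀ x, x ∈ U ∪ D ↔ ∃ n : ℤ, f x = n)
    (hU : ∀ x ∈ U, ∀ᶠ y in 𝓝[≠] x, 0 < (f y - f x) * (y - x))
    (hD : ∀ x ∈ D, ∀ᶠ y in 𝓝[≠] x, (f y - f x) * (y - x) < 0)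
    {M N : ℤ} (htop : Tendsto f atTop (𝓝 (M + 1 / 2)))
    (hbot : Tendsto f atBot (𝓝 (M - N + 1 / 2))) :
    U.Finite ∧ D.Finite ∧ N = (U.ncard : ℤ) - D.ncard := by
  classical
  have hEtop : ∀ᶠ x in atTop, ⌊f x⌋ = M ∧ ∀ n : ℤ, f x ≠ n := by
    filter_upwards [htop.eventually (lt_mem_nhds (by linarith : (M : ℝ) < M + 1 / 2)),
      htop.eventually (gt_mem_nhds (by linarith : (M : ℝ) + 1 / 2 < M + 1))] with x h1 h2
    refine ⟨Int.floor_eq_iff.2 ⟨h1.le, h2⟩, fun n hn => ?_⟩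
    rw [hn] at h1 h2
    norm_cast at h1 h2
    omega
  have hEbot : ∀ᶠ x in atBot, ⌊f x⌋ = M - N ∧ ∀ n : ℤ, f x ≠ n := by
    filter_upwards [hbot.eventually (lt_mem_nhds (by linarith : (M - N : ℝ) < M - N + 1 / 2)),
      hbot.eventually (gt_mem_nhds (by linarith : (M - N : ℝ) + 1 / 2 < M - N + 1))] with x h1 h2
    refine ⟨Int.floor_eq_iff.2 ⟨by push_cast; exact h1.le, by push_cast; exact h2⟩, fun n hn => ?_⟩
    rw [hn] at h1 h2
    norm_cast at h1 h2
    omega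
  have hfin : (U ∪ D).Finite := by
    obtain ⟨a, ha⟩ := eventually_atTop.1 hEtop
    obtain ⟨b, hb⟩ := eventually_atBot.1 hEbot
    by_contra hinf
    -- An accumulation point is impossible. If `f x` is an integer, the crossing hypotheses isolate
    -- `x`; otherwise `f` stays strictly between two consecutive integers near `x`.
    obtain ⟨x, -, hx⟩ := Set.Infinite.exists_accPt_of_subset_isCompact hinf
      (isCompact_Icc (a := b) (b := a)) (fun x hx => by
        obtain ⟨n, hn⟩ := (hUD x).1 hx
        exact ⟨not_lt.1 fun h => (hb x h.le).2 n hn, not_lt.1 fun h => (ha x h.le).2 n hn⟩)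
    rw [accPt_iff_frequently_nhdsNE] at hx
    have hc : ContinuousAt f x := hf.continuousAt
    by_cases hxn : ∃ n : ℤ, f x = n
    · have hne : ∀ᶠ y in 𝓝[≠] x, f y ≠ f x := by
        rcases (hUD x).2 hxn with h | h
        · filter_upwards [hU x h] with y hy e
          rw [e, sub_self, zero_mul] at hy
          exact hy.false
        · filter_upwards [hD x h] with y hy e
          rw [e, sub_self, zero_mul] at hy
          exact hy.false
      obtain ⟨n, hn⟩ := hxn
      refine hx ?_
      filter_upwards [hne, (hc.eventually (lt_mem_nhds (sub_one_lt (f x)))).filter_mono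
        nhdsWithin_le_nhds, (hc.eventually (gt_mem_nhds (lt_add_one (f x)))).filter_mono
        nhdsWithin_le_nhds] with y h1 h2 h3 hy
      obtain ⟨k, hk⟩ := (hUD y).1 hy
      rw [hk, hn] at h1 h2 h3
      norm_cast at h1 h2 h3
      omega
    · push Not at hxn
      have hfl := Int.floor_eventuallyEq_of_notMem_range hc hxn
      refine hx ?_
      have h1 : (⌊f x⌋ : ℝ) < f x := lt_of_le_of_ne (Int.floor_le _) (hxn _).symm
      filter_upwards [(hc.eventually (lt_mem_nhds h1)).filter_mono nhdsWithin_le_nhds,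
        hfl.filter_mono nhdsWithin_le_nhds] with y h2 h3 hy
      obtain ⟨k, hk⟩ := (hUD y).1 hy
      rw [hk, Int.floor_intCast] at h3
      rw [hk, ← h3] at h2
      exact h2.false
  have hUf : U.Finite := hfin.subset Set.subset_union_left
  have hDf : D.Finite := hfin.subset Set.subset_union_right
  refine ⟨hUf, hDf, ?_⟩
  have hdisj : ∀ x ∈ U, x ∉ D := fun x hxU hxD => by
    obtain ⟨y, h1, h2⟩ := ((hU x hxU).and (hD x hxD)).exists
    linarith
  set A := hUf.toFinset
  set B := hDf.toFinset
  have hA : ∀ x, x ∈ A ↔ x ∈ U := fun x => hUf.mem_toFinset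
  have hB : ∀ x, x ∈ B ↔ x ∈ D := fun x => hDf.mem_toFinset
  rw [Set.ncard_eq_toFinset_card U hUf, Set.ncard_eq_toFinset_card D hDf]
  have hle : ∀ S : Finset ℝ, ∀ x ∉ S, ∀ᶠ y in 𝓝 x,
      ∑ s ∈ S, (if s ≤ y then (1 : ℤ) else 0) = ∑ s ∈ S, if s ≤ x then (1 : ℤ) else 0 := by
    intro S x hx
    have : ∀ᶠ y in 𝓝 x, ∀ s ∈ S, (s ≤ y ↔ s ≤ x) := by
      refine (Finset.eventually_all S).2 fun s hs => ?_
      rcases lt_or_gt_of_ne (fun h => hx (h ▸ hs) : s ≠ x) with h | h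
      · filter_upwards [lt_mem_nhds h] with y hy using ⟨fun _ => h.le, fun _ => le_of_lt hy⟩
      · filter_upwards [gt_mem_nhds h] with y hy using
          ⟨fun h' => absurd hy (not_lt.2 h'), fun h' => absurd h (not_lt.2 h')⟩
    filter_upwards [this] with y hy
    exact Finset.sum_congr rfl fun s hs => by simp only [hy s hs]
  have hlt : ∀ S : Finset ℝ, ∀ x ∉ S, ∀ᶠ y in 𝓝 x,
      ∑ s ∈ S, (if s < y then (1 : ℤ) else 0) = ∑ s ∈ S, if s < x then (1 : ℤ) else 0 := by
    intro S x hx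
    have : ∀ᶠ y in 𝓝 x, ∀ s ∈ S, (s < y ↔ s < x) := by
      refine (Finset.eventually_all S).2 fun s hs => ?_
      rcases lt_or_gt_of_ne (fun h => hx (h ▸ hs) : s ≠ x) with h | h
      · filter_upwards [lt_mem_nhds h] with y hy using ⟨fun _ => h, fun _ => hy⟩
      · filter_upwards [gt_mem_nhds h] with y hy using
          ⟨fun h' => absurd hy h'.not_gt, fun h' => absurd h h'.not_gt⟩
    filter_upwards [this] with y hy
    exact Finset.sum_congr rfl fun s hs => by simp only [hy s hs]
  -- At an upward crossing `⌊f⌋` has already jumped at the point itself; at a downward one it drops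
  -- only just after. Hence `≤` for `A` and `<` for `B`: with this choice `J` is locally constant,
  -- and its values near `±∞` give the count.
  set J : ℝ → ℤ := fun x => ⌊f x⌋ - ∑ s ∈ A, (if s ≤ x then (1 : ℤ) else 0) +
    ∑ s ∈ B, (if s < x then (1 : ℤ) else 0) with hJ
  have hJc : IsLocallyConstant J := by
    refine (IsLocallyConstant.iff_eventually_eq J).2 fun x => ?_
    have hc : ContinuousAt f x := hf.continuousAt
    by_cases hx : ∃ n : ℤ, f x = n
    · have hfx := (hUD x).2 hx
      obtain ⟨n, hn⟩ := hx
      have hnear : ∀ᶠ y in 𝓝 x, (n : ℝ) - 1 < f y ∧ f y < n + 1 := by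
        rw [← hn]
        exact (hc.eventually (lt_mem_nhds (sub_one_lt (f x)))).and
          (hc.eventually (gt_mem_nhds (lt_add_one (f x))))
      have hfl1 : ∀ y, (n : ℝ) - 1 < f y → f y < n + 1 → f y < n → ⌊f y⌋ = n - 1 :=
        fun y h1 h2 h3 => Int.floor_eq_iff.2 ⟨by push_cast; exact h1.le, by push_cast; linarith⟩
      have hfl2 : ∀ y, (n : ℝ) - 1 < f y → f y < n + 1 → n ≤ f y → ⌊f y⌋ = n :=
        fun y h1 h2 h3 => Int.floor_eq_iff.2 ⟨h3, h2⟩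
      have hflx : ⌊f x⌋ = n := by rw [hn, Int.floor_intCast]
      rcases hfx with hxU | hxD
      · have hcr := eventually_nhdsWithin_iff.1 (hU x hxU)
        filter_upwards [hnear, hcr, hle (A.erase x) x (Finset.notMem_erase x A),
          hlt B x (fun h => hdisj x hxU ((hB x).1 h))] with y h1 h2 h3 h4
        simp only [hJ]
        rw [← Finset.add_sum_erase A _ ((hA x).2 hxU), ← Finset.add_sum_erase A _ ((hA x).2 hxU),
          h3, h4, hflx, if_pos le_rfl]
        rcases lt_trichotomy y x with h | h | h
        · have h5 := h2 h.ne
          rw [hn] at h5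
          rw [if_neg (not_le.2 h), hfl1 y h1.1 h1.2 (by nlinarith)]
          ring
        · rw [h, if_pos le_rfl, hflx]
        · have h5 := h2 h.ne'
          rw [hn] at h5
          rw [if_pos h.le, hfl2 y h1.1 h1.2 (by nlinarith)]
      · have hcr := eventually_nhdsWithin_iff.1 (hD x hxD)
        filter_upwards [hnear, hcr, hlt (B.erase x) x (Finset.notMem_erase x B),
          hle A x (fun h => hdisj x ((hA x).1 h) hxD)] with y h1 h2 h3 h4
        simp only [hJ]
        rw [← Finset.add_sum_erase B _ ((hB x).2 hxD), ← Finset.add_sum_erase B _ ((hB x).2 hxD),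
          h3, h4, hflx, if_neg (lt_irrefl x)]
        rcases lt_trichotomy y x with h | h | h
        · have h5 := h2 h.ne
          rw [hn] at h5
          rw [if_neg (not_lt.2 h.le), hfl2 y h1.1 h1.2 (by nlinarith)]
        · rw [h, if_neg (lt_irrefl x), hflx]
        · have h5 := h2 h.ne'
          rw [hn] at h5
          rw [if_pos h, hfl1 y h1.1 h1.2 (by nlinarith)]
          ring
    · have hxA : x ∉ A := fun h => hx ((hUD x).1 (Or.inl ((hA x).1 h)))
      have hxB : x ∉ B := fun h => hx ((hUD x).1 (Or.inr ((hB x).1 h)))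
      push Not at hx
      filter_upwards [Int.floor_eventuallyEq_of_notMem_range hc hx, hle A x hxA, hlt B x hxB]
        with y h1 h2 h3
      simp only [hJ, h1, h2, h3]
  obtain ⟨x, ⟨hx1, -⟩, hxA, hxB⟩ := (hEtop.and (((Finset.eventually_all A).2 fun s _ =>
    eventually_ge_atTop s).and ((Finset.eventually_all B).2 fun s _ =>
    eventually_gt_atTop s))).exists
  obtain ⟨y, ⟨hy1, -⟩, hyA, hyB⟩ := (hEbot.and (((Finset.eventually_all A).2 fun s _ =>
    eventually_lt_atBot s).and ((Finset.eventually_all B).2 fun s _ =>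
    eventually_le_atBot s))).exists
  have hxy := hJc.apply_eq_of_isPreconnected isPreconnected_univ (Set.mem_univ x) (Set.mem_univ y)
  simp only [hJ] at hxy
  rw [hx1, hy1, Finset.sum_congr rfl fun s hs => if_pos (hxA s hs),
    Finset.sum_congr rfl fun s hs => if_pos (hxB s hs),
    Finset.sum_congr rfl fun s hs => if_neg (not_le.2 (hyA s hs)),
    Finset.sum_congr rfl fun s hs => if_neg (not_lt.2 (hyB s hs))] at hxy
  simp only [Finset.sum_const, nsmul_eq_mul, mul_one, mul_zero] at hxy
  change N = (A.card : ℤ) - B.card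
  omega

theorem Real.sin_two_pi_mul_sub_int_mul_pos {a : ℝ} {n : ℤ} (h1 : (n : ℝ) - 1 / 2 < a)
    (h2 : a < n + 1 / 2) (h3 : a ≠ n) : 0 < Real.sin (2 * Real.pi * a) * (a - n) := by
  have e : Real.sin (2 * Real.pi * a) = Real.sin (2 * Real.pi * (a - n)) := by
    rw [← Real.sin_sub_int_mul_two_pi _ n]; congr 1; ring
  rw [e]
  have hpi := Real.pi_pos
  rcases lt_or_gt_of_ne h3 with h | h
  · refine mul_pos_of_neg_of_neg (Real.sin_neg_of_neg_of_neg_pi_lt ?_ ?_) (by linarith)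
    · exact mul_neg_of_pos_of_neg (by positivity) (by linarith)
    · nlinarith
  · refine mul_pos (Real.sin_pos_of_pos_of_lt_pi ?_ ?_) (by linarith)
    · exact mul_pos (by positivity) (by linarith)
    · nlinarith

/-- Counting signed crossings of the negative real axis: a nonvanishing curve `γ` whose imaginary
part is `-π ψ` with `ψ` having only simple zeros. -/
theorem card_negative_axis_crossings {ψ Θ : ℝ → ℝ} {γ : ℝ → ℂ} (hψ : Differentiable ℝ ψ)
    (hsimple : ∀ s, ψ s = 0 → deriv ψ s ≠ 0) (hγ0 : ∀ s, γ s ≠ 0)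
    (him : ∀ s, (γ s).im = -(Real.pi * ψ s)) (hΘ : Continuous Θ)
    (hphase : ∀ s, γ s = ‖γ s‖ * exp (Θ s * I)) {M N : ℤ}
    (htop : Tendsto Θ atTop (𝓝 (2 * Real.pi * M)))
    (hbot : Tendsto Θ atBot (𝓝 (2 * Real.pi * (M - N)))) :
    {s | ψ s = 0 ∧ 0 < deriv ψ s ∧ (γ s).re < 0}.Finite ∧
    {s | ψ s = 0 ∧ deriv ψ s < 0 ∧ (γ s).re < 0}.Finite ∧
    N = ({s | ψ s = 0 ∧ 0 < deriv ψ s ∧ (γ s).re < 0}.ncard : ℤ) -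
      {s | ψ s = 0 ∧ deriv ψ s < 0 ∧ (γ s).re < 0}.ncard := by
  have hpi := Real.pi_pos
  -- Normalized so that `f` is an integer exactly when `γ` is on the negative real axis; the limits
  -- of `Θ` become half-integers.
  set f : ℝ → ℝ := fun s => (Θ s + Real.pi) / (2 * Real.pi) with hfdef
  have hfΘ : ∀ s, Θ s = 2 * Real.pi * f s - Real.pi := fun s => by simp only [hfdef]; field_simp; ring
  have hfc : Continuous f := by fun_prop
  have hre : ∀ s, (γ s).re = -(‖γ s‖ * Real.cos (2 * Real.pi * f s)) := fun s => by
    have := congrArg re (hphase s)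
    rwa [re_ofReal_mul, exp_ofReal_mul_I_re, hfΘ, Real.cos_sub_pi, mul_neg] at this
  have him' : ∀ s, Real.pi * ψ s = ‖γ s‖ * Real.sin (2 * Real.pi * f s) := fun s => by
    have := congrArg im (hphase s)
    rw [im_ofReal_mul, exp_ofReal_mul_I_im, hfΘ, Real.sin_sub_pi, mul_neg, him] at this
    exact neg_injective this
  have hnorm : ∀ s, 0 < ‖γ s‖ := fun s => norm_pos_iff.2 (hγ0 s)
  have hint : ∀ s, (∃ n : ℤ, f s = n) ↔ ψ s = 0 ∧ (γ s).re < 0 := fun s => by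
    constructor
    · rintro ⟨n, hn⟩
      have e : 2 * Real.pi * f s = n * (2 * Real.pi) := by rw [hn]; ring
      have h1 := him' s
      have h2 := hre s
      rw [e, Real.cos_int_mul_two_pi] at h2
      have e' : (n : ℝ) * (2 * Real.pi) = (2 * n : ℤ) * Real.pi := by push_cast; ring
      rw [e, e', Real.sin_int_mul_pi, mul_zero] at h1
      refine ⟨(mul_eq_zero.1 h1).resolve_left hpi.ne', ?_⟩
      rw [h2]
      linarith [hnorm s]
    · rintro ⟨h1, h2⟩
      have h3 := him' s
      rw [h1, mul_zero, zero_eq_mul] at h3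
      have h4 : Real.sin (2 * Real.pi * f s) = 0 := h3.resolve_left (hnorm s).ne'
      have h5 : 0 < Real.cos (2 * Real.pi * f s) := by
        rw [hre s] at h2
        exact pos_of_mul_pos_right (by linarith) (hnorm s).le
      have h6 : Real.cos (2 * Real.pi * f s) = 1 := by
        have := Real.sin_sq_add_cos_sq (2 * Real.pi * f s)
        rw [h4] at this
        nlinarith
      obtain ⟨n, hn⟩ := (Real.cos_eq_one_iff _).1 h6
      refine ⟨n, ?_⟩
      have : 2 * Real.pi * (n - f s) = 0 := by linarith
      have := (mul_eq_zero.1 this).resolve_left (by positivity)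
      linarith
  -- Near `s`, `f y - f s` has the sign of `sin (2 π f y)`, hence of `ψ y`. The factor `deriv ψ s`
  -- treats both directions of crossing at once.
  have hcross : ∀ s, ψ s = 0 → (γ s).re < 0 →
      ∀ᶠ y in 𝓝[≠] s, 0 < (f y - f s) * (y - s) * deriv ψ s := fun s hs hneg => by
    obtain ⟨n, hn⟩ := (hint s).2 ⟨hs, hneg⟩
    have hslope := ((hasDerivAt_iff_tendsto_slope.1 (hψ s).hasDerivAt).mul_const
      (deriv ψ s)).eventually (lt_mem_nhds (mul_self_pos.2 (hsimple s hs)))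
    have hfs : ContinuousAt f s := hfc.continuousAt
    have h1 : ∀ᶠ y in 𝓝 s, (n : ℝ) - 1 / 2 < f y :=
      hfs.eventually (lt_mem_nhds (by rw [hn]; linarith))
    have h2 : ∀ᶠ y in 𝓝 s, f y < n + 1 / 2 :=
      hfs.eventually (gt_mem_nhds (by rw [hn]; linarith))
    filter_upwards [hslope, h1.filter_mono nhdsWithin_le_nhds, h2.filter_mono nhdsWithin_le_nhds,
      self_mem_nhdsWithin] with y hy hy1 hy2 hys
    have hys' : 0 < (y - s) ^ 2 := by
      have : y - s ≠ 0 := sub_ne_zero.2 hys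
      positivity
    have hy' : 0 < ψ y * (y - s) * deriv ψ s := by
      have := mul_pos hys' hy
      rw [slope_def_field, hs, sub_zero] at this
      have e : (y - s) ^ 2 * (ψ y / (y - s) * deriv ψ s) = ψ y * (y - s) * deriv ψ s := by
        have : y - s ≠ 0 := sub_ne_zero.2 hys
        field_simp
      rwa [e] at this
    have hψy : ψ y ≠ 0 := fun h => by rw [h] at hy'; simp at hy'
    have hfy : f y ≠ n := fun h => by
      have := ((hint y).1 ⟨n, h⟩).1
      exact hψy this
    have h3 := mul_pos (hnorm y) (Real.sin_two_pi_mul_sub_int_mul_pos hy1 hy2 hfy)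
    rw [← mul_assoc, ← him' y] at h3
    rw [hn]
    have h4 : 0 < ψ y * (f y - n) := pos_of_mul_pos_right (by linarith : 0 < Real.pi * (ψ y * (f y - n))) hpi.le
    have h5 : 0 < ψ y ^ 2 * ((f y - n) * (y - s) * deriv ψ s) := by
      have := mul_pos hy' h4
      linarith
    exact pos_of_mul_pos_right h5 (by positivity)
  refine card_crossings (M := M) hfc (fun s => ?_) (fun s hs => ?_) (fun s hs => ?_) ?_ ?_
  · rw [hint]
    constructor
    · rintro (h | h) <;> exact ⟨h.1, h.2.2⟩
    · rintro ⟨h1, h2⟩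
      rcases lt_or_gt_of_ne (hsimple s h1) with h | h
      · exact Or.inr ⟨h1, h, h2⟩
      · exact Or.inl ⟨h1, h, h2⟩
  · filter_upwards [hcross s hs.1 hs.2.2] with y hy using pos_of_mul_pos_left hy hs.2.1.le
  · filter_upwards [hcross s hs.1 hs.2.2] with y hy using neg_of_mul_pos_left hy hs.2.1.le
  · have := (htop.add_const Real.pi).div_const (2 * Real.pi)
    convert this using 2
    field_simp
  · have := (hbot.add_const Real.pi).div_const (2 * Real.pi)
    convert this using 2
    field_simp

/-! ### The Cauchy transform: analyticity, boundary values, decay. -/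

/-- The Cauchy transform `∫ ψ(v) / (v - w) dv`. -/
noncomputable def cauchyTransform (ψ : ℝ → ℝ) (w : ℂ) : ℂ := ∫ v : ℝ, (ψ v : ℂ) / (v - w)

section Cauchy

variable {ψ : ℝ → ℝ}

theorem im_le_norm_ofReal_sub {w : ℂ} (v : ℝ) : w.im ≤ ‖(v - w : ℂ)‖ := by
  have := abs_im_le_norm (v - w : ℂ)
  simp only [sub_im, ofReal_im, zero_sub, abs_neg] at this
  exact (le_abs_self _).trans this

theorem abs_sub_re_le_norm_ofReal_sub {w : ℂ} (v : ℝ) : |v - w.re| ≤ ‖(v - w : ℂ)‖ := by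
  simpa using abs_re_le_norm (v - w : ℂ)

theorem ofReal_sub_ne_zero_of_im_pos {w : ℂ} (hw : 0 < w.im) (v : ℝ) : (v - w : ℂ) ≠ 0 :=
  norm_pos_iff.1 (hw.trans_le (im_le_norm_ofReal_sub v))

theorem continuous_inv_ofReal_sub {w : ℂ} (hw : 0 < w.im) :
    Continuous fun v : ℝ => (v - w : ℂ)⁻¹ :=
  Continuous.inv₀ (by fun_prop) (ofReal_sub_ne_zero_of_im_pos hw)

theorem MeasureTheory.Integrable.div_ofReal_sub (hψ : Integrable ψ) {w : ℂ} (hw : 0 < w.im) :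
    Integrable fun v : ℝ => (ψ v : ℂ) / (v - w) := by
  simp only [div_eq_mul_inv]
  refine hψ.ofReal.mul_bdd (c := w.im⁻¹) (continuous_inv_ofReal_sub hw).aestronglyMeasurable
    (Eventually.of_forall fun v => ?_)
  rw [norm_inv]
  exact inv_anti₀ hw (im_le_norm_ofReal_sub v)

theorem norm_cauchyTransform_le (hψ : Integrable ψ) {w : ℂ} (hw : 0 < w.im) :
    ‖cauchyTransform ψ w‖ ≤ (∫ v, |ψ v|) / w.im := by
  rw [← integral_div]
  refine norm_integral_le_of_norm_le (hψ.abs.div_const _) (Eventually.of_forall fun v => ?_)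
  rw [norm_div, norm_real, Real.norm_eq_abs]
  exact div_le_div_of_nonneg_left (abs_nonneg _) hw (im_le_norm_ofReal_sub v)

theorem differentiableAt_cauchyTransform (hψ : Integrable ψ) {w : ℂ} (hw : 0 < w.im) :
    DifferentiableAt ℂ (cauchyTransform ψ) w := by
  have hball : ∀ z ∈ Metric.ball w (w.im / 2), w.im / 2 < z.im := fun z hz => by
    have h1 := (abs_im_le_norm (z - w)).trans_lt (by simpa [dist_eq_norm] using hz)
    rw [sub_im] at h1
    linarith [neg_abs_le (z.im - w.im)]
  refine (hasDerivAt_integral_of_dominated_loc_of_deriv_le (μ := volume)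
    (F := fun (z : ℂ) (v : ℝ) => (ψ v : ℂ) / (v - z))
    (F' := fun (z : ℂ) (v : ℝ) => (ψ v : ℂ) / (v - z) ^ 2)
    (bound := fun v => |ψ v| / (w.im / 2) ^ 2) (Metric.ball_mem_nhds w (half_pos hw))
    ?_ (hψ.div_ofReal_sub hw) ?_ ?_ (hψ.abs.div_const _) ?_).2.differentiableAt
  · filter_upwards [Metric.ball_mem_nhds w (half_pos hw)] with z hz
    exact (hψ.div_ofReal_sub ((half_pos hw).trans (hball z hz))).aestronglyMeasurable
  · simp only [div_eq_mul_inv]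
    exact hψ.ofReal.aestronglyMeasurable.mul (Continuous.inv₀ (by fun_prop)
      fun v => pow_ne_zero 2 (ofReal_sub_ne_zero_of_im_pos hw v)).aestronglyMeasurable
  · refine Eventually.of_forall fun v z hz => ?_
    rw [norm_div, norm_real, Real.norm_eq_abs, norm_pow]
    have h1 := (hball z hz).le.trans (im_le_norm_ofReal_sub v)
    exact div_le_div_of_nonneg_left (abs_nonneg _) (by positivity)
      (pow_le_pow_left₀ (half_pos hw).le h1 2)
  · refine Eventually.of_forall fun v z hz => ?_
    have hne := ofReal_sub_ne_zero_of_im_pos ((half_pos hw).trans (hball z hz)) v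
    have h1 : HasDerivAt (fun z : ℂ => (v - z : ℂ)) (-1) z := by
      simpa using (hasDerivAt_id z).const_sub (v : ℂ)
    have h2 := (h1.fun_inv hne).const_mul (ψ v : ℂ)
    simp only [neg_neg] at h2
    simpa only [div_eq_mul_inv, one_mul] using h2

theorem integral_inv_ofReal_sub {w : ℂ} (hw : 0 < w.im) (a b : ℝ) :
    ∫ v in a..b, (v - w : ℂ)⁻¹ = log (b - w) - log (a - w) := by
  refine intervalIntegral.integral_eq_sub_of_hasDerivAt (f := fun v : ℝ => log (v - w))
    (fun v _ => ?_) ((continuous_inv_ofReal_sub hw).intervalIntegrable _ _)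
  have h1 : HasDerivAt (fun v : ℝ => (v - w : ℂ)) 1 v :=
    (hasDerivAt_id v).ofReal_comp.sub_const w
  have h2 : (v - w : ℂ) ∈ slitPlane := Or.inr (by simpa using hw.ne')
  simpa using h1.clog_real h2

/-- Subtracting a constant `c` from the density on an interval. -/
theorem cauchyTransform_eq_add (hψ : Integrable ψ) {w : ℂ} (hw : 0 < w.im) {a b : ℝ} (hab : a ≤ b)
    (c : ℝ) : cauchyTransform ψ w =
      (∫ v : ℝ, ((ψ v - (Set.Ioc a b).indicator (fun _ => c) v : ℝ) : ℂ) / (v - w)) +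
        c * (log (b - w) - log (a - w)) := by
  have hI : IntegrableOn (fun v : ℝ => (v - w : ℂ)⁻¹) (Set.Ioc a b) :=
    ((continuous_inv_ofReal_sub hw).intervalIntegrable a b).1
  have e : (fun v : ℝ => ((ψ v - (Set.Ioc a b).indicator (fun _ => c) v : ℝ) : ℂ) / (v - w)) =
      fun v => (ψ v : ℂ) / (v - w) - (Set.Ioc a b).indicator (fun v : ℝ => c * (v - w : ℂ)⁻¹) v := by
    funext v
    by_cases hv : v ∈ Set.Ioc a b
    · simp only [Set.indicator_of_mem hv]; push_cast; ring
    · simp only [Set.indicator_of_notMem hv]; push_cast; ring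
  rw [e, integral_sub (hψ.div_ofReal_sub hw)
    ((integrable_indicator_iff measurableSet_Ioc).2 (hI.const_mul _)),
    integral_indicator measurableSet_Ioc, integral_const_mul,
    ← intervalIntegral.integral_of_le hab, integral_inv_ofReal_sub hw, cauchyTransform]
  ring

/-- The endpoints are symmetric about `w.re`, so the moduli agree and only the arguments contribute.
-/
theorem norm_log_sub_log_le (w : ℂ) (δ : ℝ) :
    ‖log ((w.re + δ : ℝ) - w) - log ((w.re - δ : ℝ) - w)‖ ≤ 2 * Real.pi := by
  have hn : ‖((w.re + δ : ℝ) - w : ℂ)‖ = ‖((w.re - δ : ℝ) - w : ℂ)‖ := by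
    rw [norm_eq_sqrt_sq_add_sq, norm_eq_sqrt_sq_add_sq]
    simp
  refine (norm_le_abs_re_add_abs_im _).trans ?_
  rw [sub_re, sub_im, log_re, log_re, hn, sub_self, abs_zero, zero_add, log_im, log_im]
  refine (abs_sub _ _).trans ?_
  linarith [abs_arg_le_pi ((w.re + δ : ℝ) - w : ℂ), abs_arg_le_pi ((w.re - δ : ℝ) - w : ℂ)]

/-- As `w` approaches `s` from above, `s - 1 - w` approaches `-1` from below the cut, where `log`
tends to `-π i`. -/
theorem tendsto_log_sub_log {s : ℝ} :
    Tendsto (fun w : ℂ => log ((s + 1 : ℝ) - w) - log ((s - 1 : ℝ) - w)) (𝓝[{w | 0 < w.im}] s)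
      (𝓝 (Real.pi * I)) := by
  have h1 : Tendsto (fun w : ℂ => log ((s + 1 : ℝ) - w)) (𝓝[{w | 0 < w.im}] s) (𝓝 0) := by
    have : ContinuousAt (fun w : ℂ => log ((s + 1 : ℝ) - w)) s :=
      ContinuousAt.clog (by fun_prop) (by simp)
    have h := this.tendsto.mono_left (nhdsWithin_le_nhds (s := {w | 0 < w.im}))
    simpa using h
  have h2 : Tendsto (fun w : ℂ => log ((s - 1 : ℝ) - w)) (𝓝[{w | 0 < w.im}] s)
      (𝓝 (-(Real.pi * I))) := by
    have h := tendsto_log_nhdsWithin_im_neg_of_re_neg_of_im_zero (z := -1) (by simp) (by simp)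
    simp only [norm_neg, norm_one, Real.log_one, ofReal_zero, zero_sub] at h
    refine h.comp (tendsto_nhdsWithin_iff.2 ⟨?_, ?_⟩)
    · have : ContinuousAt (fun w : ℂ => ((s - 1 : ℝ) - w : ℂ)) s := by fun_prop
      have h' := this.tendsto.mono_left (nhdsWithin_le_nhds (s := {w | 0 < w.im}))
      simpa using h'
    · filter_upwards [self_mem_nhdsWithin] with w hw
      simpa using hw
  simpa using h1.sub h2

/-- Boundary values of the Cauchy transform of an integrable Lipschitz function (Plemelj). -/
theorem exists_tendsto_cauchyTransform (hψ : Integrable ψ) {M : ℝ}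
    (hM : ∀ x y, |ψ x - ψ y| ≤ M * |x - y|) (s : ℝ) :
    ∃ r : ℝ, (ψ s = 0 → r = ∫ v, ψ v / (v - s)) ∧
      Tendsto (cauchyTransform ψ) (𝓝[{w | 0 < w.im}] s) (𝓝 (r + ψ s * (Real.pi * I))) := by
  have hM0 : 0 ≤ M := by simpa using (abs_nonneg _).trans (hM 1 0)
  have hψc : Continuous ψ :=
    (LipschitzWith.of_dist_le_mul (K := M.toNNReal) fun x y => by
      rw [Real.coe_toNNReal M hM0]; exact hM x y).continuous
  set A : Set ℝ := Set.Ioc (s - 1) (s + 1)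
  refine ⟨∫ v, (ψ v - A.indicator (fun _ => ψ s) v) / (v - s), fun h => by simp [h], ?_⟩
  -- The subtracted constant is `ψ w.re`, not `ψ s`: then the Lipschitz bound controls the numerator
  -- by `M * |v - w.re| ≤ M * ‖v - w‖`, uniformly for every mode of approach to `s`.
  have hmain : Tendsto (fun w : ℂ => ∫ v : ℝ, ((ψ v - A.indicator (fun _ => ψ w.re) v : ℝ) : ℂ) /
      (v - w)) (𝓝[{w | 0 < w.im}] s)
      (𝓝 (∫ v : ℝ, ((ψ v - A.indicator (fun _ => ψ s) v : ℝ) : ℂ) / (v - s))) := by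
    have hev : ∀ᶠ w : ℂ in 𝓝[{w | 0 < w.im}] s, |w.re - s| < 1 / 2 := by
      refine Filter.Eventually.filter_mono nhdsWithin_le_nhds ?_
      have : ContinuousAt (fun w : ℂ => |w.re - s|) s := by fun_prop
      exact this.eventually (gt_mem_nhds (by simp))
    -- Outside `A`, `|v - s| ≥ 1` and `|w.re - s| < 1 / 2` give `‖v - w‖ ≥ 1 / 2`, whence the factor
    -- `2`.
    refine tendsto_integral_filter_of_dominated_convergence
      (fun v => A.indicator (fun _ => M) v + 2 * |ψ v|) ?_ ?_ ?_ ?_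
    · filter_upwards [self_mem_nhdsWithin] with w hw
      simp only [div_eq_mul_inv]
      refine AEStronglyMeasurable.mul ?_ (continuous_inv_ofReal_sub hw).aestronglyMeasurable
      refine (Measurable.aestronglyMeasurable ?_)
      exact measurable_ofReal.comp
        (hψc.measurable.sub (measurable_const.indicator measurableSet_Ioc))
    · filter_upwards [self_mem_nhdsWithin, hev] with w hw hws
      have hw : 0 < w.im := hw
      refine Eventually.of_forall fun v => ?_
      have hpos := norm_pos_iff.2 (ofReal_sub_ne_zero_of_im_pos hw v)
      have hre := abs_sub_re_le_norm_ofReal_sub (w := w) v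
      rw [norm_div, norm_real, Real.norm_eq_abs, div_le_iff₀ hpos]
      by_cases hv : v ∈ A
      · rw [Set.indicator_of_mem hv, Set.indicator_of_mem hv]
        calc _ ≤ M * |v - w.re| := hM _ _
          _ ≤ M * ‖(v - w : ℂ)‖ := by gcongr
          _ ≤ _ := by gcongr; linarith [abs_nonneg (ψ v)]
      · rw [Set.indicator_of_notMem hv, Set.indicator_of_notMem hv, sub_zero, zero_add]
        have h1 : 1 ≤ |v - s| := by
          rw [Set.mem_Ioc, not_and_or, not_lt, not_le] at hv
          rcases hv with hv | hv
          · exact le_abs.2 (Or.inr (by linarith))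
          · exact le_abs.2 (Or.inl (by linarith))
        have h2 : |v - s| ≤ |v - w.re| + |w.re - s| := abs_sub_le _ _ _
        have h3 : 1 / 2 ≤ ‖(v - w : ℂ)‖ := by linarith
        nlinarith [abs_nonneg (ψ v)]
    · refine Integrable.add ?_ (hψ.abs.const_mul 2)
      exact (integrable_indicator_iff measurableSet_Ioc).2 (by simp)
    · have hae : ∀ᵐ v : ℝ, v ≠ s := by simp [ae_iff]
      filter_upwards [hae] with v hv
      have hvs : (v - s : ℂ) ≠ 0 := by rw [← ofReal_sub]; exact ofReal_ne_zero.2 (sub_ne_zero.2 hv)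
      have hc : ContinuousAt (fun w : ℂ => A.indicator (fun _ => ψ w.re) v) s := by
        by_cases hvA : v ∈ A
        · simp only [Set.indicator_of_mem hvA]; fun_prop
        · simp only [Set.indicator_of_notMem hvA]; fun_prop
      have : ContinuousAt (fun w : ℂ => ((ψ v - A.indicator (fun _ => ψ w.re) v : ℝ) : ℂ) /
          (v - w)) s := by
        refine ContinuousAt.div ?_ (by fun_prop) hvs
        exact continuous_ofReal.continuousAt.comp (f := fun w : ℂ =>
          ψ v - A.indicator (fun _ => ψ w.re) v) (continuousAt_const.sub hc)
      have h := this.tendsto.mono_left (nhdsWithin_le_nhds (s := {w | 0 < w.im}))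
      simpa only [ofReal_re] using h
  have hreal : (∫ v : ℝ, ((ψ v - A.indicator (fun _ => ψ s) v : ℝ) : ℂ) / (v - s)) =
      ((∫ v, (ψ v - A.indicator (fun _ => ψ s) v) / (v - s) : ℝ) : ℂ) := by
    rw [← integral_complex_ofReal]
    push_cast
    rfl
  rw [hreal] at hmain
  have hψre : Tendsto (fun w : ℂ => (ψ w.re : ℂ)) (𝓝[{w | 0 < w.im}] s) (𝓝 (ψ s)) := by
    have : ContinuousAt (fun w : ℂ => (ψ w.re : ℂ)) s := by fun_prop
    simpa using this.tendsto.mono_left (nhdsWithin_le_nhds (s := {w | 0 < w.im}))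
  refine (hmain.add (hψre.mul tendsto_log_sub_log)).congr' ?_
  filter_upwards [self_mem_nhdsWithin] with w hw
  exact (cauchyTransform_eq_add hψ hw (by linarith) _).symm

/-- Dominated convergence: the excised interval gives the bound `|ψ v| / δ`, and for fixed `v` the
denominator grows with `|w.re|`. -/
theorem tendsto_integral_compl_Ioc_div (hψ : Integrable ψ) {δ : ℝ} (hδ : 0 < δ) :
    Tendsto (fun w : ℂ => ∫ v : ℝ, |(Set.Ioc (w.re - δ) (w.re + δ))ᶜ.indicator ψ v| / ‖(v - w : ℂ)‖)
      (comap (fun w : ℂ => |w.re|) atTop ⊓ 𝓟 {w | 0 < w.im}) (𝓝 0) := by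
  rw [show 𝓝 (0 : ℝ) = 𝓝 (∫ _ : ℝ, (0 : ℝ)) by rw [integral_zero]]
  refine tendsto_integral_filter_of_dominated_convergence (fun v => |ψ v| / δ) ?_ ?_
    (hψ.abs.div_const _) ?_
  · refine Eventually.of_forall fun w => ?_
    simp only [div_eq_mul_inv]
    refine ((hψ.indicator measurableSet_Ioc.compl).abs.aestronglyMeasurable).mul ?_
    exact Measurable.aestronglyMeasurable (by fun_prop)
  · filter_upwards with w
    refine Eventually.of_forall fun v => ?_
    rw [Real.norm_eq_abs, abs_div, abs_abs, abs_norm]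
    by_cases hv : v ∈ Set.Ioc (w.re - δ) (w.re + δ)
    · rw [Set.indicator_of_notMem (by simpa using hv), abs_zero, zero_div]
      positivity
    · rw [Set.indicator_of_mem hv]
      have h1 : δ ≤ |v - w.re| := by
        rw [Set.mem_Ioc, not_and_or, not_lt, not_le] at hv
        rcases hv with hv | hv
        · exact le_abs.2 (Or.inr (by linarith))
        · exact le_abs.2 (Or.inl (by linarith))
      exact div_le_div_of_nonneg_left (abs_nonneg _) hδ
        (h1.trans (abs_sub_re_le_norm_ofReal_sub v))
  · refine Eventually.of_forall fun v => ?_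
    have hlim : Tendsto (fun w : ℂ => |ψ v| * (|w.re| - |v|)⁻¹)
        (comap (fun w : ℂ => |w.re|) atTop ⊓ 𝓟 {w | 0 < w.im}) (𝓝 (|ψ v| * 0)) :=
      ((tendsto_inv_atTop_zero.comp ((tendsto_atTop_add_const_right _ (-|v|) tendsto_comap).mono_left
        inf_le_left))).const_mul _
    rw [mul_zero] at hlim
    refine squeeze_zero' (Eventually.of_forall fun w => by positivity) ?_ hlim
    have : ∀ᶠ w : ℂ in comap (fun w : ℂ => |w.re|) atTop ⊓ 𝓟 {w | 0 < w.im}, |v| < |w.re| :=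
      (tendsto_comap.eventually (eventually_gt_atTop |v|)).filter_mono inf_le_left
    filter_upwards [this] with w hw
    rw [div_eq_mul_inv]
    have h1 : |w.re| - |v| ≤ ‖(v - w : ℂ)‖ := by
      have := abs_sub_abs_le_abs_sub w.re v
      rw [abs_sub_comm] at this
      exact this.trans (abs_sub_re_le_norm_ofReal_sub v)
    have h2 : |(Set.Ioc (w.re - δ) (w.re + δ))ᶜ.indicator ψ v| ≤ |ψ v| := by
      by_cases hv : v ∈ (Set.Ioc (w.re - δ) (w.re + δ))ᶜ
      · rw [Set.indicator_of_mem hv]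
      · rw [Set.indicator_of_notMem hv, abs_zero]; positivity
    exact mul_le_mul h2 (inv_anti₀ (by linarith) h1) (by positivity) (abs_nonneg _)

/-- The Cauchy transform of an integrable Lipschitz function vanishing at infinity tends to zero
at infinity in the upper half-plane, uniformly up to the boundary. -/
theorem tendsto_cauchyTransform_cobounded (hψ : Integrable ψ) {M : ℝ}
    (hM : ∀ x y, |ψ x - ψ y| ≤ M * |x - y|) (hbot : Tendsto ψ atBot (𝓝 0))
    (htop : Tendsto ψ atTop (𝓝 0)) :
    Tendsto (cauchyTransform ψ) (cobounded ℂ ⊓ 𝓟 {w | 0 < w.im}) (𝓝 0) := by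
  have hM0 : 0 ≤ M := by simpa using (abs_nonneg _).trans (hM 1 0)
  rw [Metric.tendsto_nhds]
  intro ε hε
  -- For large `|w.re|`, three terms of size at most `ε / 4` are balanced: the Lipschitz part on an
  -- interval of length `2 * δ`, the far part, and the logarithmic part, which is small because `ψ
  -- w.re` is.
  set δ : ℝ := ε / (8 * (M + 1))
  have hδ : 0 < δ := by positivity
  have hMδ : M * (2 * δ) ≤ ε / 4 := by
    have : (M + 1) * (2 * δ) = ε / 4 := by simp only [δ]; field_simp; ring
    nlinarith
  have hψinf : ∀ᶠ t in atTop, ∀ x : ℝ, |x| = t → |ψ x| < ε / (8 * Real.pi) := by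
    have hε' : 0 < ε / (8 * Real.pi) := by positivity
    obtain ⟨a, ha⟩ := eventually_atTop.1 (Metric.tendsto_nhds.1 htop _ hε')
    obtain ⟨b, hb⟩ := eventually_atBot.1 (Metric.tendsto_nhds.1 hbot _ hε')
    filter_upwards [eventually_ge_atTop (max a (-b))] with t ht x hx
    rcases abs_cases x with ⟨h, -⟩ | ⟨h, -⟩
    · simpa using ha x (by linarith [le_max_left a (-b)])
    · simpa using hb x (by linarith [le_max_right a (-b)])
  have hreal : ∀ᶠ w : ℂ in comap (fun w : ℂ => |w.re|) atTop ⊓ 𝓟 {w | 0 < w.im},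
      ‖cauchyTransform ψ w‖ < ε := by
    filter_upwards [(Metric.tendsto_nhds.1 (tendsto_integral_compl_Ioc_div hψ hδ) (ε / 4)
      (by positivity)), (tendsto_comap.eventually hψinf).filter_mono inf_le_left,
      mem_inf_of_right (mem_principal_self _)] with w hfar hψw hw
    have hw : 0 < w.im := hw
    rw [cauchyTransform_eq_add hψ hw (by linarith : w.re - δ ≤ w.re + δ) (ψ w.re)]
    set A := Set.Ioc (w.re - δ) (w.re + δ)
    have h1 : ‖(ψ w.re : ℂ) * (log ((w.re + δ : ℝ) - w) - log ((w.re - δ : ℝ) - w))‖ ≤ ε / 4 := by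
      rw [norm_mul, norm_real, Real.norm_eq_abs]
      calc _ ≤ ε / (8 * Real.pi) * (2 * Real.pi) := mul_le_mul (hψw _ rfl).le
              (norm_log_sub_log_le w δ) (norm_nonneg _) (by positivity)
        _ = ε / 4 := by field_simp; ring
    have hInt1 : Integrable fun v : ℝ => |Aᶜ.indicator ψ v| / ‖(v - w : ℂ)‖ := by
      have := (((hψ.indicator (measurableSet_Ioc (a := w.re - δ) (b := w.re + δ)).compl)).div_ofReal_sub
        hw).norm
      simpa only [norm_div, norm_real, Real.norm_eq_abs] using this
    have hInt2 : Integrable (A.indicator fun _ : ℝ => M) :=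
      (integrable_indicator_iff measurableSet_Ioc).2 (by simp)
    have h2 : ‖∫ v : ℝ, ((ψ v - A.indicator (fun _ => ψ w.re) v : ℝ) : ℂ) / (v - w)‖ ≤
        (∫ v : ℝ, |Aᶜ.indicator ψ v| / ‖(v - w : ℂ)‖) + M * (2 * δ) := by
      have e : ∫ v, A.indicator (fun _ : ℝ => M) v = M * (2 * δ) := by
        rw [integral_indicator measurableSet_Ioc, setIntegral_const, Real.volume_real_Ioc_of_le
          (by linarith), smul_eq_mul]
        ring
      rw [← e, ← integral_add hInt1 hInt2]
      refine norm_integral_le_of_norm_le (hInt1.add hInt2) (Eventually.of_forall fun v => ?_)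
      have hpos := norm_pos_iff.2 (ofReal_sub_ne_zero_of_im_pos hw v)
      rw [norm_div, norm_real, Real.norm_eq_abs]
      by_cases hv : v ∈ A
      · rw [Set.indicator_of_mem hv, Set.indicator_of_notMem (by simpa using hv : v ∉ Aᶜ),
          Set.indicator_of_mem hv, abs_zero, zero_div, zero_add, div_le_iff₀ hpos]
        exact (hM _ _).trans (mul_le_mul_of_nonneg_left (abs_sub_re_le_norm_ofReal_sub v) hM0)
      · rw [Set.indicator_of_notMem hv, Set.indicator_of_mem (by simpa using hv : v ∈ Aᶜ),
          Set.indicator_of_notMem hv, sub_zero, add_zero]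
    rw [Real.dist_eq, sub_zero] at hfar
    have h3 := (le_abs_self _).trans_lt hfar
    refine (norm_add_le _ _).trans_lt ?_
    linarith
  rw [eventually_inf_principal, eventually_comap] at hreal
  obtain ⟨R, hR⟩ := eventually_atTop.1 hreal
  -- If `|w.re|` stays below `R` while `‖w‖` is large, then `w.im` exceeds `H`, and the crude bound
  -- by `(∫ |ψ|) / w.im` is enough.
  set H : ℝ := (∫ v, |ψ v|) / ε + 1
  have hI : 0 ≤ ∫ v, |ψ v| := integral_nonneg fun v => abs_nonneg _
  have hH : 0 < H := by positivity
  rw [eventually_inf_principal]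
  have hlarge : ∀ᶠ w : ℂ in cobounded ℂ, R + H < ‖w‖ :=
    tendsto_norm_cobounded_atTop.eventually (eventually_gt_atTop _)
  filter_upwards [hlarge] with w hwn hw
  have hw : 0 < w.im := hw
  rw [dist_zero_right]
  rcases le_or_gt R |w.re| with h | h
  · exact hR _ h w rfl hw
  · have h1 : H < w.im := by
      have := norm_le_abs_re_add_abs_im w
      rw [abs_of_pos hw] at this
      linarith
    refine (norm_cauchyTransform_le hψ hw).trans_lt ?_
    rw [div_lt_iff₀ hw]
    have h2 : (∫ v, |ψ v|) < ε * H := by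
      have : ε * H = (∫ v, |ψ v|) + ε := by simp only [H]; field_simp
      linarith
    nlinarith

end Cauchy

/-! ### The Penrose criterion for a normalized profile. -/

theorem abs_sub_le_of_abs_deriv_le {ψ : ℝ → ℝ} {M : ℝ} (hψ : Differentiable ℝ ψ)
    (hM : ∀ v, |deriv ψ v| ≤ M) (x y : ℝ) : |ψ x - ψ y| ≤ M * |x - y| := by
  simpa using Convex.norm_image_sub_le_of_norm_deriv_le (f := ψ) (s := Set.univ)
    (fun z _ => hψ z) (fun z _ => hM z) convex_univ (Set.mem_univ y) (Set.mem_univ x)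

theorem closure_setOf_zero_lt_re : closure {z : ℂ | 0 < z.re} = {z | 0 ≤ z.re} :=
  closure_setOfPred_lt_re 0

/-- The Penrose criterion in normalized form, for the function `z ↦ 1 - ∫ ψ(v) / (v - i z) dv`. -/
theorem penrose_criterion {ψ : ℝ → ℝ} (hψ : Integrable ψ) (hbot : Tendsto ψ atBot (𝓝 0))
    (htop : Tendsto ψ atTop (𝓝 0)) (hdiff : Differentiable ℝ ψ) {M : ℝ}
    (hM : ∀ v, |deriv ψ v| ≤ M) (hsimple : ∀ s, ψ s = 0 → deriv ψ s ≠ 0) {p : ℝ → ℝ}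
    (hp : ∀ s, p s = 1 - ∫ v, ψ v / (v - s)) (hp0 : ∀ s, ψ s = 0 → p s ≠ 0) {F : ℂ → ℂ}
    (hF : ∀ z, F z = 1 - cauchyTransform ψ (I * z)) :
    AnalyticOnNhd ℂ F {z | 0 < z.re} ∧ {z | 0 < z.re ∧ F z = 0}.Finite ∧
    {s | ψ s = 0 ∧ 0 < deriv ψ s ∧ p s < 0}.Finite ∧
    {s | ψ s = 0 ∧ deriv ψ s < 0 ∧ p s < 0}.Finite ∧
    ((∑ᶠ z ∈ {z | 0 < z.re ∧ F z = 0}, analyticOrderNatAt F z : ℕ) : ℤ) =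
      ({s | ψ s = 0 ∧ 0 < deriv ψ s ∧ p s < 0}.ncard : ℤ) -
        {s | ψ s = 0 ∧ deriv ψ s < 0 ∧ p s < 0}.ncard := by
  have hLip := abs_sub_le_of_abs_deriv_le hdiff hM
  have hopen : IsOpen {z : ℂ | 0 < z.re} := isOpen_lt continuous_const continuous_re
  have hFd : DifferentiableOn ℂ F {z | 0 < z.re} := fun z hz => by
    have hz : 0 < (I * z).im := by simpa using hz
    rw [funext hF]
    exact ((differentiableAt_const _).sub ((differentiableAt_cauchyTransform hψ hz).comp z
      (by fun_prop))).differentiableWithinAt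
  have hFa : AnalyticOnNhd ℂ F {z | 0 < z.re} := hFd.analyticOnNhd hopen
  have hbd : ∀ z : ℂ, z.re = 0 → ∃ r : ℝ, (ψ (-z.im) = 0 → r = p (-z.im)) ∧
      Tendsto F (𝓝[{z | 0 < z.re}] z) (𝓝 (r - ψ (-z.im) * (Real.pi * I))) := fun z hz => by
    obtain ⟨r, hr, hlim⟩ := exists_tendsto_cauchyTransform hψ hLip (-z.im)
    refine ⟨1 - r, fun h => by rw [hr h, hp], ?_⟩
    have hz' : I * z = (-z.im : ℝ) := by apply Complex.ext <;> simp [hz]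
    have hmap : Tendsto (fun w : ℂ => I * w) (𝓝[{z | 0 < z.re}] z)
        (𝓝[{w | 0 < w.im}] ((-z.im : ℝ) : ℂ)) := by
      refine tendsto_nhdsWithin_iff.2 ⟨?_, ?_⟩
      · rw [← hz']
        exact (Continuous.tendsto (by fun_prop) z).mono_left nhdsWithin_le_nhds
      · filter_upwards [self_mem_nhdsWithin] with w hw
        simpa using hw
    have := (hlim.comp hmap).const_sub 1
    rw [funext hF, show ((1 - r : ℝ) - ψ (-z.im) * (Real.pi * I) : ℂ) =
      1 - (r + ψ (-z.im) * (Real.pi * I)) by push_cast; ring]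
    exact this
  set g : ℂ → ℂ := extendFrom {z : ℂ | 0 < z.re} F with hg
  have hgF : ∀ z ∈ {z : ℂ | 0 < z.re}, g z = F z := extendFrom_extends hFd.continuousOn
  have hcl : {z : ℂ | 0 ≤ z.re} ⊆ closure {z | 0 < z.re} := closure_setOf_zero_lt_re.ge
  have hlim : ∀ z ∈ {z : ℂ | 0 ≤ z.re}, ∃ y, Tendsto F (𝓝[{z | 0 < z.re}] z) (𝓝 y) :=
    fun z hz => by
      rcases (show 0 ≤ z.re from hz).lt_or_eq with h | h
      · exact ⟨F z, hFd.continuousOn z h⟩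
      · obtain ⟨r, -, hr⟩ := hbd z h.symm
        exact ⟨_, hr⟩
  have hgc : ContinuousOn g {z | 0 ≤ z.re} := continuousOn_extendFrom hcl hlim
  have hgb : ∀ z : ℂ, z.re = 0 → ∃ r : ℝ, (ψ (-z.im) = 0 → r = p (-z.im)) ∧
      g z = r - ψ (-z.im) * (Real.pi * I) := fun z hz => by
    obtain ⟨r, hr, hlim⟩ := hbd z hz
    exact ⟨r, hr, extendFrom_eq (hcl hz.ge) hlim⟩
  have hgim : ∀ z : ℂ, z.re = 0 → (g z).im = -(Real.pi * ψ (-z.im)) := fun z hz => by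
    obtain ⟨r, -, h⟩ := hgb z hz
    rw [h]
    simp [mul_comm]
  have hgre : ∀ z : ℂ, z.re = 0 → ψ (-z.im) = 0 → (g z).re = p (-z.im) := fun z hz h0 => by
    obtain ⟨r, hr, h⟩ := hgb z hz
    rw [h, hr h0]
    simp
  -- A boundary zero would need `ψ = 0` from the imaginary part and then `p = 0` from the real part.
  have hg0 : ∀ z : ℂ, z.re = 0 → g z ≠ 0 := fun z hz h => by
    have h1 := hgim z hz
    rw [h, zero_im, zero_eq_neg] at h1
    have h2 := (mul_eq_zero.1 h1).resolve_left Real.pi_ne_zero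
    have h3 := hgre z hz h2
    rw [h, zero_re] at h3
    exact hp0 _ h2 h3.symm
  have hga : AnalyticOnNhd ℂ g {z | 0 < z.re} := fun z hz =>
    (hFa z hz).congr (by filter_upwards [hopen.mem_nhds hz] with w hw using (hgF w hw).symm)
  have hFinf : Tendsto F (cobounded ℂ ⊓ 𝓟 {z | 0 < z.re}) (𝓝 1) := by
    have hmap : Tendsto (fun w : ℂ => I * w) (cobounded ℂ ⊓ 𝓟 {z | 0 < z.re})
        (cobounded ℂ ⊓ 𝓟 {w | 0 < w.im}) := by
      refine (tendsto_mul_left_cobounded I_ne_zero).inf (tendsto_principal_principal.2 ?_)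
      intro w hw
      simpa using hw
    have := ((tendsto_cauchyTransform_cobounded hψ hLip hbot htop).comp hmap).const_sub 1
    rw [sub_zero] at this
    rwa [funext hF]
  -- Boundary values of `g` are limits of interior values of `F`, so the estimate for `F` off a
  -- closed ball passes to the closed half-plane.
  have hginf : Tendsto g (cobounded ℂ ⊓ 𝓟 {z | 0 ≤ z.re}) (𝓝 1) := by
    rw [Metric.tendsto_nhds]
    intro ε hε
    have h1 := (Metric.tendsto_nhds.1 hFinf) (ε / 2) (half_pos hε)
    rw [eventually_inf_principal] at h1 ⊢
    obtain ⟨R, -, hR⟩ := (Metric.hasBasis_cobounded_compl_closedBall (0 : ℂ)).eventually_iff.1 h1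
    refine (Metric.hasBasis_cobounded_compl_closedBall (0 : ℂ)).eventually_iff.2
      ⟨R, trivial, fun z hz hzre => ?_⟩
    have : (𝓝[{z : ℂ | 0 < z.re}] z).NeBot := mem_closure_iff_nhdsWithin_neBot.1 (hcl hzre)
    have h2 : Tendsto F (𝓝[{z | 0 < z.re}] z) (𝓝 (g z)) := tendsto_extendFrom (hlim z hzre)
    refine (le_of_tendsto (h2.dist tendsto_const_nhds) ?_).trans_lt (half_lt_self hε)
    filter_upwards [self_mem_nhdsWithin,
      mem_nhdsWithin_of_mem_nhds (Metric.isClosed_closedBall.isOpen_compl.mem_nhds hz)] with w hw hwR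
    exact (hR hwR hw).le
  obtain ⟨Θ, m, hΘc, hΘ, hΘtop, hΘbot⟩ := exists_continuous_phase_of_halfPlane hgc hga hg0 hginf
  have hset : {z | 0 < z.re ∧ g z = 0} = {z | 0 < z.re ∧ F z = 0} :=
    Set.ext fun z => and_congr_right fun hz => by rw [hgF z hz]
  have hsum : ∑ᶠ z ∈ {z | 0 < z.re ∧ g z = 0}, analyticOrderNatAt g z =
      ∑ᶠ z ∈ {z | 0 < z.re ∧ F z = 0}, analyticOrderNatAt F z := by
    rw [hset]
    refine finsum_mem_congr rfl fun z hz => ?_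
    unfold analyticOrderNatAt
    rw [analyticOrderAt_congr (by filter_upwards [hopen.mem_nhds hz.1] with w hw using hgF w hw)]
  rw [hsum] at hΘbot
  have hax : ∀ s : ℝ, (-(I * s) : ℂ).re = 0 := fun s => by simp
  have hax' : ∀ s : ℝ, -(-(I * s) : ℂ).im = s := fun s => by simp
  obtain ⟨hU, hD, hN⟩ := card_negative_axis_crossings (γ := fun s : ℝ => g (-(I * s))) hdiff hsimple
    (fun s => hg0 _ (hax s)) (fun s => by rw [hgim _ (hax s), hax']) hΘc hΘ hΘtop
    (N := ((∑ᶠ z ∈ {z | 0 < z.re ∧ F z = 0}, analyticOrderNatAt F z : ℕ) : ℤ)) (by exact_mod_cast hΘbot)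
  have hre : ∀ s, ψ s = 0 → (g (-(I * s))).re = p s := fun s hs => by
    rw [hgre _ (hax s) (by rwa [hax']), hax']
  have hUe : {s : ℝ | ψ s = 0 ∧ 0 < deriv ψ s ∧ (g (-(I * s))).re < 0} =
      {s | ψ s = 0 ∧ 0 < deriv ψ s ∧ p s < 0} :=
    Set.ext fun s => and_congr_right fun hs => by rw [hre s hs]
  have hDe : {s : ℝ | ψ s = 0 ∧ deriv ψ s < 0 ∧ (g (-(I * s))).re < 0} =
      {s | ψ s = 0 ∧ deriv ψ s < 0 ∧ p s < 0} :=
    Set.ext fun s => and_congr_right fun hs => by rw [hre s hs]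
  rw [hUe] at hU hN
  rw [hDe] at hD hN
  exact ⟨hFa, hset ▸ (finite_zeros_of_halfPlane hgc hga hg0 hginf).1, hU, hD, hN⟩

/-! ### Reduction of `Δ(k, ·)` to the normalized form. -/

/-- The rescaled profile for which the dispersion function at wave number `1` is that of `φ` at `k`.
-/
noncomputable def rescaledProfile (φ : ℝ → ℝ) (k : ℝ) (u : ℝ) : ℝ := φ (u / k) / (k * |k|)

theorem landauDelta_eq_cauchyTransform (φ : ℝ → ℝ) {k : ℝ} (hk : k ≠ 0) (z : ℂ) :
    landauDelta φ k z = 1 - cauchyTransform (rescaledProfile φ k) (I * z) := by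
  have hk' : (k : ℂ) ≠ 0 := ofReal_ne_zero.2 hk
  have hka : ((|k| : ℝ) : ℂ) ≠ 0 := ofReal_ne_zero.2 (abs_ne_zero.2 hk)
  have h1 : cauchyTransform (rescaledProfile φ k) (I * z) =
      |k| • ∫ v : ℝ, ((φ v / (k * |k|) : ℝ) : ℂ) / ((k * v : ℝ) - I * z) := by
    rw [← Measure.integral_comp_div _ k, cauchyTransform]
    simp only [rescaledProfile, mul_div_cancel₀ _ hk]
  rw [landauDelta, if_neg hk, h1, real_smul, ← integral_const_mul, ← integral_const_mul,
    sub_eq_add_neg, ← integral_neg]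
  congr 2
  funext v
  have h2 : I * (k : ℂ) * v + z = I * ((k * v : ℝ) - I * z) := by
    push_cast
    linear_combination z * I_sq
  rw [h2]
  generalize ((k * v : ℝ) - I * z : ℂ) = d
  have h3 : (1 : ℂ) / (I * k) * (φ v / (I * d)) = -(φ v / (k * d)) := by
    rw [div_mul_div_comm, show I * k * (I * d) = -(k * d) by linear_combination k * d * I_sq,
      one_mul, div_neg]
  rw [h3, ofReal_div, ofReal_mul]
  field_simp

theorem penroseValue_eq (φ : ℝ → ℝ) {k : ℝ} (hk : k ≠ 0) (s : ℝ) :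
    penroseValue φ k s = 1 - ∫ u, rescaledProfile φ k u / (u - k * s) := by
  have h1 : ∫ u, rescaledProfile φ k u / (u - k * s) =
      |k| • ∫ v : ℝ, φ v / (k * |k|) / (k * v - k * s) := by
    rw [← Measure.integral_comp_div _ k]
    simp only [rescaledProfile, mul_div_cancel₀ _ hk]
  have hka : |k| ≠ 0 := abs_ne_zero.2 hk
  rw [penroseValue, h1, smul_eq_mul, ← integral_const_mul, ← integral_const_mul]
  congr 2
  funext v
  -- At `v = s` both integrands are `0` by the convention for division by zero.
  by_cases h0 : v - s = 0
  · have : k * v - k * s = 0 := by rw [← mul_sub, h0, mul_zero]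
    simp [h0, this]
  · rw [← mul_sub]
    field_simp

/-- The factor `k * (k * |k|)` is positive for either sign of `k`: reflection and change of sign
cancel, so rising zeros stay rising. -/
theorem deriv_rescaledProfile {φ : ℝ → ℝ} (hφ : Differentiable ℝ φ) (k u : ℝ) :
    deriv (rescaledProfile φ k) u = deriv φ (u / k) / (k * (k * |k|)) := by
  have h1 : HasDerivAt (fun u : ℝ => φ (u / k)) (deriv φ (u / k) * (1 / k)) u :=
    (hφ (u / k)).hasDerivAt.comp u ((hasDerivAt_id u).div_const k)
  have h2 := (h1.div_const (k * |k|)).deriv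
  rw [show rescaledProfile φ k = fun u => φ (u / k) / (k * |k|) from rfl, h2]
  rw [mul_one_div, div_div]

/-! ### The two statements of the theorem. -/

theorem theorem3 (φ : ℝ → ℝ)
    (hL1 : MeasureTheory.Integrable φ)
    (hbot : Filter.Tendsto φ Filter.atBot (nhds 0))
    (htop : Filter.Tendsto φ Filter.atTop (nhds 0))
    (hdiff : Differentiable ℝ φ)
    (hbdd : ∃ M : ℝ, ∀ v : ℝ, |deriv φ v| ≤ M)
    (hnondeg : ∀ s : ℝ, φ s = 0 → deriv φ s ≠ 0) :
    (∀ k : ℝ, k ≠ 0 →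
      (∀ s : ℝ, φ s = 0 → penroseValue φ k s ≠ 0) →
        AnalyticOnNhd ℂ (landauDelta φ k) {z : ℂ | 0 < z.re} ∧
        (unstableRoots φ k).Finite ∧
        (upZeros φ k).Finite ∧
        (downZeros φ k).Finite ∧
        (instabilityIndex φ k : ℤ) =
          ((upZeros φ k).ncard : ℤ) - ((downZeros φ k).ncard : ℤ)) ∧
    (MeasureTheory.Integrable (fun v : ℝ => v * φ v) →
      (unstableRoots φ 0).Subsingleton ∧
      ((unstableRoots φ 0).Nonempty ↔ 0 < ∫ v : ℝ, v * φ v)) := by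
  refine ⟨fun k hk hk0 => ?_, fun _ => ?_⟩
  · obtain ⟨M, hM⟩ := hbdd
    have hka : 0 < |k| := abs_pos.2 hk
    have hc' : 0 < k * (k * |k|) := by rw [← mul_assoc]; exact mul_pos (mul_self_pos.2 hk) hka
    set ψ := rescaledProfile φ k with hψdef
    have hzero : ∀ s, ψ s = 0 ↔ φ (s / k) = 0 := fun s => by
      simp [hψdef, rescaledProfile, hk]
    have hd : ∀ s, deriv ψ s = deriv φ (s / k) / (k * (k * |k|)) := deriv_rescaledProfile hdiff k
    have hlim : Tendsto ψ atBot (𝓝 0) ∧ Tendsto ψ atTop (𝓝 0) := by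
      have key : ∀ {l l' : Filter ℝ}, Tendsto φ l (𝓝 0) → Tendsto (fun u : ℝ => u / k) l' l →
          Tendsto ψ l' (𝓝 0) := fun h1 h2 => by
        have := (h1.comp h2).div_const (k * |k|)
        rwa [zero_div] at this
      rcases lt_or_gt_of_ne hk with h | h
      · exact ⟨key htop ((tendsto_div_const_atTop_of_neg h).2 tendsto_id),
          key hbot ((tendsto_div_const_atBot_of_neg h).2 tendsto_id)⟩
      · exact ⟨key hbot (tendsto_id.atBot_div_const h), key htop (tendsto_id.atTop_div_const h)⟩
    have hψi : Integrable ψ := (hL1.comp_div hk).div_const _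
    have hψd : Differentiable ℝ ψ :=
      (hdiff.comp (differentiable_id.div_const k)).div_const _
    have hkk : ∀ s, k * (s / k) = s := fun s => mul_div_cancel₀ s hk
    obtain ⟨h1, h2, h3, h4, h5⟩ := penrose_criterion (M := M / (k * (k * |k|)))
      (p := fun s => penroseValue φ k (s / k)) (F := landauDelta φ k) hψi hlim.1 hlim.2 hψd
      (fun v => by
        rw [hd, abs_div, abs_of_pos hc']
        exact div_le_div_of_nonneg_right (hM _) hc'.le)
      (fun s hs => by
        rw [hd]
        exact div_ne_zero (hnondeg _ ((hzero s).1 hs)) hc'.ne')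
      (fun s => by rw [penroseValue_eq φ hk, hkk])
      (fun s hs => hk0 _ ((hzero s).1 hs)) (landauDelta_eq_cauchyTransform φ hk)
    have hR : unstableRoots φ k = {z | 0 < z.re ∧ landauDelta φ k z = 0} := Set.ext fun z =>
      ⟨fun h => ⟨h.2, h.1.2⟩, fun h => ⟨⟨h.1.ne', h.2⟩, h.1⟩⟩
    have hinj : Function.Injective fun s : ℝ => s / k := fun _ _ => (div_left_inj' hk).1
    have hsurj : Function.Surjective fun s : ℝ => s / k := fun s => ⟨k * s, mul_div_cancel_left₀ s hk⟩
    have hU : {s | ψ s = 0 ∧ 0 < deriv ψ s ∧ penroseValue φ k (s / k) < 0} =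
        (fun s => s / k) ⁻¹' upZeros φ k := Set.ext fun s => by
      simp only [upZeros, Set.mem_ofPred_eq, Set.mem_preimage, hzero, hd, div_pos_iff_of_pos_right hc']
    have hD : {s | ψ s = 0 ∧ deriv ψ s < 0 ∧ penroseValue φ k (s / k) < 0} =
        (fun s => s / k) ⁻¹' downZeros φ k := Set.ext fun s => by
      simp only [downZeros, Set.mem_ofPred_eq, Set.mem_preimage, hzero, hd, div_lt_iff₀ hc', zero_mul]
    rw [hU] at h3 h5
    rw [hD] at h4 h5
    rw [Set.ncard_preimage_of_injective_subset_range hinj (by simp [hsurj.range_eq]),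
      Set.ncard_preimage_of_injective_subset_range hinj (by simp [hsurj.range_eq])] at h5
    refine ⟨h1, hR ▸ h2, h3.of_preimage hsurj, h4.of_preimage hsurj, ?_⟩
    rw [instabilityIndex, hR]
    exact h5
  · set m : ℝ := ∫ v : ℝ, v * φ v with hm
    -- The two square roots of `m` are opposite, so at most one lies in the right half-plane; a real
    -- square with `0 < z.re` forces `z` to be real, hence `0 < m`.
    have hroot : ∀ z, z ∈ unstableRoots φ 0 ↔ 0 < z.re ∧ z ^ 2 = m := fun z => by
      constructor
      · rintro ⟨⟨-, h⟩, hz⟩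
        have hz0 : z ≠ 0 := fun h0 => by simp [h0] at hz
        rw [landauDelta, if_pos rfl, sub_eq_zero, one_div_mul_eq_div, eq_div_iff (pow_ne_zero 2 hz0),
          one_mul] at h
        exact ⟨hz, h⟩
      · rintro ⟨hz, h⟩
        have hz0 : z ≠ 0 := fun h0 => by simp [h0] at hz
        refine ⟨⟨hz.ne', ?_⟩, hz⟩
        rw [landauDelta, if_pos rfl, ← hm, ← h, one_div_mul_cancel (pow_ne_zero 2 hz0), sub_self]
    refine ⟨fun z hz w hw => ?_, fun ⟨z, hz⟩ => ?_, fun hpos => ⟨(√m : ℝ), (hroot _).2 ⟨?_, ?_⟩⟩⟩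
    · obtain ⟨hz1, hz2⟩ := (hroot z).1 hz
      obtain ⟨hw1, hw2⟩ := (hroot w).1 hw
      rcases sq_eq_sq_iff_eq_or_eq_neg.1 (hz2.trans hw2.symm) with h | h
      · exact h
      · rw [h, neg_re] at hz1
        linarith
    · obtain ⟨hz1, hz2⟩ := (hroot z).1 hz
      have him := congrArg im hz2
      have hre := congrArg re hz2
      simp only [sq, mul_im, mul_re, ofReal_im, ofReal_re] at him hre
      have h0 : z.im = 0 := by
        have : z.re * z.im = 0 := by linarith
        exact (mul_eq_zero.1 this).resolve_left hz1.ne'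
      rw [h0] at hre
      nlinarith
    · simpa using hpos
    · rw [← ofReal_pow, Real.sq_sqrt hpos.le]
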